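/- \textbf{The game.} In the renormalized $p$-processor cup game with parameters $\varepsilon,\delta$, there are $n$ initially empty cups. In each step $t=1,2,\dots$ the filler pours $c_j(t)\in[0,1]$ units of water into each cup $j$, with $\sum_j c_j(t)\le(1-\varepsilon)p$; then the emptier chooses at most $p+1$ distinct cups and removes from each of them at most $1+2\delta$ units of water (and no more than the cup contains). The filler is oblivious: the amounts $c_j(t)$ are fixed before the game. The emptier is randomized and online: its action in a step depends only on its random choices and on the amounts poured up to and including that step. The backlog after a step is the amount of water in the fullest cup. \textbf{The algorithm.} A threshold-counter algorithm with collections of size $N$ works as follows. For every cup $j$ and $b=0,1,2,\dots$, put $k=b(N+1)+1$ and draw $s_j(k)$ uniformly from $(0,1]$, all independent; the threshold collection $(j,k)$ consists of the thresholds $k+m+s_j(k)$, $m=1,\dots,N$. Cup $j$ crosses a threshold $r$ in step $t$ if $\sum_{u<t}c_j(u)<r\le\sum_{u\le t}c_j(u)$. Each cup has a counter $w_j$, initially $0$, which increases by $1+1/N$ whenever the cup crosses a threshold. After the filler's move in a step, the emptier selects $\min(p+1,n)$ cups, giving cups with $w_j\ge 1+1/N$ priority over all others and cups with $w_j\neq0$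 priority over cups with $w_j=0$; from each selected cup it removes $\min(1+2/N,w_j)$ units of water and decreases $w_j$ by the same amount. \textbf{Theorem.} There are absolute constants $A,a,C,\kappa>0$ such that the following holds for all $n$, all $p\ge1$, all $\varepsilon$ with $p^{-1/3}\le\varepsilon\le 1/2$ and all $\delta$ with $A e^{-a\varepsilon^2p}\le\delta<1$. In the renormalized $p$-processor cup game on $n$ cups with parameters $\varepsilon,\delta$ there is an emptier, namely one that runs a threshold-counter algorithm with collections of size $\lceil 1/\delta\rceil$, such that for every pouring sequence of the filler and every $i\ge0$, the backlog after step $i$ is at most $3$ with probability at least $1-Ce^{-\kappa\varepsilon^2p}$. -/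

import Mathlib

open MeasureTheory ProbabilityTheory

noncomputable section

namespace CupGame

/-- A pouring sequence of an oblivious filler on `n` cups: `c t j` is the amount of water poured
into cup `j` during the step number `t + 1`. -/
abbrev Pouring (n : ℕ) : Type := ℕ → Fin n → ℝ

/-- The filler's constraints in the renormalized `p`-processor cup game: in each step at most
`(1 - ε) p` units of water in total, and at most one unit in any cup. -/
structure IsLegalPouring (n p : ℕ) (ε : ℝ) (c : Pouring n) : Prop where
  nonneg : ∀ t j, 0 ≤ c t j
  le_one : ∀ t j, c t j ≤ 1
  sum_le : ∀ t, ∑ j, c t j ≤ (1 - ε) * p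

/-- The total amount of water poured into cup `j` during the first `i` steps. -/
def poured {n : ℕ} (c : Pouring n) (i : ℕ) (j : Fin n) : ℝ :=
  ∑ t ∈ Finset.range i, c t j

/-- The amount of water in cup `j` after `i` steps, when the filler plays `c` and `r t j` is the
amount removed from cup `j` at the end of step number `t + 1`. All cups are initially empty. -/
def fillLevel {n : ℕ} (c : Pouring n) (r : ℕ → Fin n → ℝ) : ℕ → Fin n → ℝ
  | 0 => fun _ => 0
  | t + 1 => fun j => fillLevel c r t j + c t j - r t j

/-- A (randomized, online) emptier for the renormalized `p`-processor cup game on `n` cups.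
Its random choices are the sample `ω`; `remove ω c t j` is the amount it removes from cup `j` in
step number `t + 1` if the filler plays `c`. -/
structure Emptier (n p : ℕ) (ε δ : ℝ) where
  /-- the sample space of the emptier's random choices -/
  Ω : Type
  [measurableSpace : MeasurableSpace Ω]
  /-- the law of the emptier's random choices -/
  μ : Measure Ω
  [isProbabilityMeasure : IsProbabilityMeasure μ]
  /-- the amounts removed -/
  remove : Ω → Pouring n → ℕ → Fin n → ℝ
  measurable_remove : ∀ c, IsLegalPouring n p ε c →
    ∀ t j, Measurable fun ω => remove ω c t j
  /-- The emptier is online: what it does in a step depends only on what the filler has poured up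
  to and including that step. -/
  online : ∀ ω c c', IsLegalPouring n p ε c → IsLegalPouring n p ε c' →
    ∀ t, (∀ u ≤ t, c u = c' u) → remove ω c t = remove ω c' t
  /-- Amounts are non-negative. -/
  remove_nonneg : ∀ ω c, IsLegalPouring n p ε c → ∀ t j, 0 ≤ remove ω c t j
  /-- At most `1 + 2 δ` units are removed from any cup in a step. -/
  remove_le : ∀ ω c, IsLegalPouring n p ε c → ∀ t j, remove ω c t j ≤ 1 + 2 * δ
  /-- Water is removed from at most `p + 1` distinct cups in a step. -/
  card_le : ∀ ω c, IsLegalPouring n p ε c → ∀ t, {j | remove ω c t j ≠ 0}.ncard ≤ p + 1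
  /-- No more water is removed from a cup than it contains. -/
  fill_nonneg : ∀ ω c, IsLegalPouring n p ε c → ∀ t j, 0 ≤ fillLevel c (remove ω c) t j

attribute [instance] Emptier.measurableSpace Emptier.isProbabilityMeasure

/-- The backlog after `i` steps: the amount of water in the fullest cup. -/
def Emptier.backlog {n p : ℕ} {ε δ : ℝ} (E : Emptier n p ε δ) (c : Pouring n) (i : ℕ)
    (ω : E.Ω) : ℝ :=
  ⨆ j, fillLevel c (E.remove ω c) i j

/-- The threshold number `m` (where `1 ≤ m ≤ N`) of the threshold collection number `b` in cup `j`.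
With `k = b (N + 1) + 1` it is located at `k + m + s j b`, where `s j b ∈ (0, 1]` is the random
value of the collection. -/
def threshold {n : ℕ} (N : ℕ) (s : Fin n → ℕ → ℝ) (j : Fin n) (b m : ℕ) : ℝ :=
  ((b : ℝ) * (N + 1) + 1) + m + s j b

/-- Cup `j` crosses a threshold in step number `t + 1`. -/
def Crosses {n : ℕ} (N : ℕ) (s : Fin n → ℕ → ℝ) (c : Pouring n) (t : ℕ) (j : Fin n) : Prop :=
  ∃ b m : ℕ, 1 ≤ m ∧ m ≤ N ∧
    poured c t j < threshold N s j b m ∧ threshold N s j b m ≤ poured c (t + 1) j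

open Classical in
/-- The counters in step number `t + 1` after the filler's move, where `w` are the counters at the
beginning of that step: a counter increases by `1 + 1 / N` if its cup crosses a threshold. -/
def raise {n : ℕ} (N : ℕ) (s : Fin n → ℕ → ℝ) (c : Pouring n) (t : ℕ) (w : Fin n → ℝ) :
    Fin n → ℝ :=
  fun j => w j + if Crosses N s c t j then 1 + 1 / (N : ℝ) else 0

/-- The counters after `i` steps, when `S t` is the set of cups that the emptier selects in step
number `t + 1`: the counter `w` of a selected cup decreases by `min (1 + 2 / N) w`. -/
def counter {n : ℕ} (N : ℕ) (s : Fin n → ℕ → ℝ) (c : Pouring n) (S : ℕ → Finset (Fin n)) :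
    ℕ → Fin n → ℝ
  | 0 => fun _ => 0
  | t + 1 => fun j =>
      let v := raise N s c t (counter N s c S t)
      if j ∈ S t then v j - min (1 + 2 / (N : ℝ)) (v j) else v j

/-- The selection rule: given the counters `v` after the filler's move, the emptier selects `p + 1`
cups (all cups, if there are fewer), giving priority to cups with `v j ≥ 1 + 1 / N` over all other
cups, and to cups with `v j ≠ 0` over those with `v j = 0`. -/
structure IsPrioritySelection {n : ℕ} (p N : ℕ) (v : Fin n → ℝ) (S : Finset (Fin n)) : Prop where
  card_eq : S.card = min (p + 1) n
  large_first : ∀ i ∈ S, ∀ j ∉ S, 1 + 1 / (N : ℝ) ≤ v j → 1 + 1 / (N : ℝ) ≤ v i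
  nonzero_first : ∀ i ∈ S, ∀ j ∉ S, v j ≠ 0 → v i ≠ 0

/-- The emptier `E` runs the threshold-counter algorithm with threshold collections of size `N`:
the random values `s j b` of the collections are independent and uniform in `(0, 1]`, cups are
selected by the selection rule (ties being broken in some way), and from a selected cup whose
counter is `v` the emptier removes `min (1 + 2 / N) v` units of water. -/
def Emptier.IsThresholdCounter {n p : ℕ} {ε δ : ℝ} (E : Emptier n p ε δ) (N : ℕ) : Prop :=
  ∃ (s : E.Ω → Fin n → ℕ → ℝ) (S : E.Ω → Pouring n → ℕ → Finset (Fin n)),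
    (∀ j b, Measurable fun ω => s ω j b) ∧
    (∀ ω j b, s ω j b ∈ Set.Ioc (0 : ℝ) 1) ∧
    (∀ j b, E.μ.map (fun ω => s ω j b) = volume.restrict (Set.Ioc (0 : ℝ) 1)) ∧
    iIndepFun (fun (q : Fin n × ℕ) ω => s ω q.1 q.2) E.μ ∧
    ∀ ω c, IsLegalPouring n p ε c → ∀ t,
      let v := raise N (s ω) c t (counter N (s ω) c (S ω c) t)
      IsPrioritySelection p N v (S ω c t) ∧
      ∀ j, E.remove ω c t j = if j ∈ S ω c t then min (1 + 2 / (N : ℝ)) (v j) else 0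

end CupGame

end

/-! In each cup the thresholds are at least 1 apart, so a step crosses at most one of them, and
there are `N` of them per `N + 1` units of water. A crossing is booked as `1 + 1 / N`, so the water
poured minus the water booked lies in `[0, 3]` for every value of the random offsets
(`crossCount_le_poured`, `poured_le_crossCount`). Selections lower cup and counter equally; hence
the fill level is this discrepancy plus the counter (`fillLevel_eq`). No cup is overdrawn, and the
backlog is at most 3 once all counters vanish. It remains to bound the probability that a counter is
non-zero after step `i`.

Deterministic part: follow `N * w j + K * pending`, where `pending` counts the selections needed to
clear all counters. If some non-zero counter is not selected, all `p + 1` selections are useful and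
`pending` falls unless many cups cross. Otherwise every non-zero counter is served, and removing `1
+ 2 / N` beats the possible gain `1 + 1 / N`. With `K = 2 (N + 2) / (ε p)` the potential is
dominated by a queue that loses 1 per step and gains `K` times the excess of crossings over `(1 - ε
/ 2) p`. A non-empty queue at time `i` forces a large average excess over some window ending at `i`
(`exists_window_excess`).

Probabilistic part: a threshold is uniform in a unit interval, and these intervals are disjoint, so
a step has at most `(1 - ε) p` expected crossings. Distinct collections are independent, so by
Chernoff the excess in one step is positive with probability at most `exp (-ε² p / 16)`. A union
bound handles short windows. Different steps are dependent through shared collections, but a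
collection affects at most `N` crossings; Efron–Stein then gives variance at most `N * p` per step
of a window (`variance_sum_excess_le`). Chebyshev over dyadic windows sums geometrically, uniformly
in `i`. Separating short from long near length `exp (ε² p / 32)` leaves an exponentially small
error, since `N`, of order `1 / δ`, is at most about `exp (ε² p / 192)`. -/

namespace CupGame

/-! ### Thresholds against poured water -/

/-- The threshold number `k` of cup `j`, when all its thresholds are listed in increasing order. -/
def orderedThreshold {n : ℕ} (N : ℕ) (s : Fin n → ℕ → ℝ) (j : Fin n) (k : ℕ) : ℝ :=
  threshold N s j (k / N) (k % N + 1)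

lemma orderedThreshold_mul_add {n : ℕ} {N : ℕ} (s : Fin n → ℕ → ℝ) (j : Fin n) (b : ℕ) {r : ℕ}
    (hr : r < N) :
    orderedThreshold N s j (N * b + r) = (b : ℝ) * (N + 1) + 2 + r + s j b := by
  have h1 : (N * b + r) / N = b := by
    rw [Nat.mul_add_div (by omega), Nat.div_eq_of_lt hr, add_zero]
  have h2 : (N * b + r) % N = r := by
    rw [Nat.mul_add_mod, Nat.mod_eq_of_lt hr]
  rw [orderedThreshold, h1, h2, threshold]
  push_cast
  ring

lemma exists_eq_mul_add {N : ℕ} (hN : 0 < N) (k : ℕ) : ∃ b r, r < N ∧ k = N * b + r :=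
  ⟨k / N, k % N, Nat.mod_lt _ hN, (Nat.div_add_mod k N).symm⟩

section

variable {n N : ℕ} {s : Fin n → ℕ → ℝ} (hN : 0 < N) (hs : ∀ j b, s j b ∈ Set.Ioc (0 : ℝ) 1)
include hN hs

/-- Inside a collection the gap is exactly 1; between two collections it is `2 + s' - s`, which is
at least 1 because both offsets lie in `(0, 1]`. This is why a position is skipped after every `N`
thresholds. -/
lemma orderedThreshold_add_one_le (j : Fin n) (k : ℕ) :
    orderedThreshold N s j k + 1 ≤ orderedThreshold N s j (k + 1) := by
  obtain ⟨b, r, hr, rfl⟩ := exists_eq_mul_add hN k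
  rcases Nat.lt_or_ge (r + 1) N with h | h
  · rw [add_assoc (N * b), orderedThreshold_mul_add s j b h, orderedThreshold_mul_add s j b hr]
    push_cast
    linarith
  · have e : N * b + r + 1 = N * (b + 1) + 0 := by rw [mul_add]; omega
    have e' : (N : ℝ) = r + 1 := by exact_mod_cast (by omega : N = r + 1)
    rw [e, orderedThreshold_mul_add s j (b + 1) hN, orderedThreshold_mul_add s j b hr]
    have := (hs j b).2
    have := (hs j (b + 1)).1
    push_cast
    nlinarith

lemma orderedThreshold_monotone (j : Fin n) : Monotone (orderedThreshold N s j) :=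
  monotone_nat_of_le_succ fun k => by linarith [orderedThreshold_add_one_le hN hs j k]

lemma orderedThreshold_le (j : Fin n) (k : ℕ) :
    orderedThreshold N s j k ≤ 3 + (1 + 1 / (N : ℝ)) * k := by
  obtain ⟨b, r, hr, rfl⟩ := exists_eq_mul_add hN k
  rw [orderedThreshold_mul_add s j b hr]
  have hN' : (0 : ℝ) < N := by exact_mod_cast hN
  have e : (1 + 1 / (N : ℝ)) * ((N * b + r : ℕ) : ℝ) = b * (N + 1) + r + r / N := by
    push_cast; field_simp; ring
  have h0 : (0 : ℝ) ≤ r / N := by positivity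
  rw [e]
  linarith [(hs j b).2]

lemma le_orderedThreshold (j : Fin n) (k : ℕ) :
    (1 + 1 / (N : ℝ)) * (k + 1) ≤ orderedThreshold N s j k := by
  obtain ⟨b, r, hr, rfl⟩ := exists_eq_mul_add hN k
  rw [orderedThreshold_mul_add s j b hr]
  have hN' : (0 : ℝ) < N := by exact_mod_cast hN
  have e : (1 + 1 / (N : ℝ)) * (((N * b + r : ℕ) : ℝ) + 1) =
      b * (N + 1) + (r + 1) + (r + 1) / N := by
    push_cast; field_simp; ring
  have h0 : ((r : ℝ) + 1) / N ≤ 1 := by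
    rw [div_le_one hN']; exact_mod_cast hr
  rw [e]
  linarith [(hs j b).1]

omit hs in
lemma crosses_iff {c : Pouring n} {t : ℕ} {j : Fin n} :
    Crosses N s c t j ↔
      ∃ k, poured c t j < orderedThreshold N s j k ∧
        orderedThreshold N s j k ≤ poured c (t + 1) j := by
  constructor
  · rintro ⟨b, m, h1, h2, h3⟩
    refine ⟨N * b + (m - 1), ?_⟩
    have : threshold N s j b m = orderedThreshold N s j (N * b + (m - 1)) := by
      rw [orderedThreshold_mul_add s j b (by omega), threshold, Nat.cast_sub h1]
      push_cast
      ring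
    rwa [← this]
  · rintro ⟨k, h⟩
    exact ⟨k / N, k % N + 1, by omega, Nat.mod_lt _ hN, h⟩

end

open Classical in
/-- The number of steps among the first `t` in which cup `j` crosses a threshold. -/
noncomputable def crossCount {n : ℕ} (N : ℕ) (s : Fin n → ℕ → ℝ) (c : Pouring n) (t : ℕ)
    (j : Fin n) : ℕ :=
  ∑ u ∈ Finset.range t, if Crosses N s c u j then 1 else 0

lemma poured_succ {n : ℕ} (c : Pouring n) (t : ℕ) (j : Fin n) :
    poured c (t + 1) j = poured c t j + c t j := by
  rw [poured, Finset.sum_range_succ, poured]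

lemma poured_zero {n : ℕ} (c : Pouring n) (j : Fin n) : poured c 0 j = 0 := by
  simp [poured]

lemma IsLegalPouring.poured_mono {n p : ℕ} {ε : ℝ} {c : Pouring n} (hc : IsLegalPouring n p ε c)
    (j : Fin n) : Monotone fun t => poured c t j :=
  monotone_nat_of_le_succ fun t => by rw [poured_succ]; linarith [hc.nonneg t j]

lemma IsLegalPouring.poured_nonneg {n p : ℕ} {ε : ℝ} {c : Pouring n}
    (hc : IsLegalPouring n p ε c) (t : ℕ) (j : Fin n) : 0 ≤ poured c t j :=
  Finset.sum_nonneg fun u _ => hc.nonneg u j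

lemma IsLegalPouring.poured_le {n p : ℕ} {ε : ℝ} {c : Pouring n}
    (hc : IsLegalPouring n p ε c) (t : ℕ) (j : Fin n) : poured c t j ≤ t :=
  (Finset.sum_le_sum fun u _ => hc.le_one u j).trans (by simp)

section

variable {n p N : ℕ} {ε : ℝ} {s : Fin n → ℕ → ℝ} {c : Pouring n}
  (hN : 0 < N) (hs : ∀ j b, s j b ∈ Set.Ioc (0 : ℝ) 1) (hc : IsLegalPouring n p ε c)
include hN hs hc

/-- The thresholds passed by the water poured so far are exactly the first `crossCount` ones. -/
lemma poured_between (t : ℕ) (j : Fin n) :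
    poured c t j < orderedThreshold N s j (crossCount N s c t j) ∧
      ∀ k < crossCount N s c t j, orderedThreshold N s j k ≤ poured c t j := by
  induction t with
  | zero =>
    refine ⟨?_, by simp [crossCount]⟩
    rw [poured_zero]
    have h := le_orderedThreshold hN hs j (crossCount N s c 0 j)
    have : (0 : ℝ) < (1 + 1 / (N : ℝ)) * ((crossCount N s c 0 j : ℝ) + 1) := by positivity
    linarith
  | succ t ih =>
    obtain ⟨h1, h2⟩ := ih
    have hmono := orderedThreshold_monotone hN hs j
    by_cases hX : Crosses N s c t j
    · have e : crossCount N s c (t + 1) j = crossCount N s c t j + 1 := by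
        rw [crossCount, Finset.sum_range_succ, if_pos hX, crossCount]
      obtain ⟨k, hk1, hk2⟩ := (crosses_iff hN).1 hX
      have hk : crossCount N s c t j ≤ k := by
        by_contra hlt
        push Not at hlt
        linarith [h2 k hlt]
      have h3 := hmono hk
      rw [e, poured_succ]
      rw [poured_succ] at hk2
      refine ⟨?_, fun l hl => ?_⟩
      · linarith [hc.le_one t j, orderedThreshold_add_one_le hN hs j (crossCount N s c t j)]
      · linarith [hmono (Nat.lt_succ_iff.1 hl)]
    · have e : crossCount N s c (t + 1) j = crossCount N s c t j := by
        rw [crossCount, Finset.sum_range_succ, if_neg hX, crossCount, add_zero]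
      rw [e]
      refine ⟨?_, fun l hl => (h2 l hl).trans (hc.poured_mono j t.le_succ)⟩
      by_contra hlt
      push Not at hlt
      exact hX ((crosses_iff hN).2 ⟨_, h1, hlt⟩)

lemma crossCount_le_poured (t : ℕ) (j : Fin n) :
    (1 + 1 / (N : ℝ)) * crossCount N s c t j ≤ poured c t j := by
  rcases h : crossCount N s c t j with _ | k
  · simpa using hc.poured_nonneg t j
  · have h1 := (poured_between hN hs hc t j).2 k (by omega)
    push_cast
    exact (le_orderedThreshold hN hs j k).trans h1

lemma poured_le_crossCount (t : ℕ) (j : Fin n) :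
    poured c t j ≤ 3 + (1 + 1 / (N : ℝ)) * crossCount N s c t j :=
  (poured_between hN hs hc t j).1.le.trans (orderedThreshold_le hN hs j _)

end

/-! ### Counters and fill levels -/

lemma counter_succ {n : ℕ} (N : ℕ) (s : Fin n → ℕ → ℝ) (c : Pouring n)
    (S : ℕ → Finset (Fin n)) (t : ℕ) (j : Fin n) :
    counter N s c S (t + 1) j = raise N s c t (counter N s c S t) j -
      if j ∈ S t then min (1 + 2 / (N : ℝ)) (raise N s c t (counter N s c S t) j) else 0 := by
  by_cases h : j ∈ S t <;> simp [counter, h]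

lemma le_raise {n : ℕ} (N : ℕ) (s : Fin n → ℕ → ℝ) (c : Pouring n) (t : ℕ) (w : Fin n → ℝ)
    (j : Fin n) : w j ≤ raise N s c t w j := by
  rw [raise]
  split_ifs
  · have : (0 : ℝ) ≤ 1 + 1 / (N : ℝ) := by positivity
    linarith
  · simp

lemma raise_le {n : ℕ} (N : ℕ) (s : Fin n → ℕ → ℝ) (c : Pouring n) (t : ℕ) (w : Fin n → ℝ)
    (j : Fin n) : raise N s c t w j ≤ w j + (1 + 1 / (N : ℝ)) := by
  rw [raise]
  split_ifs
  · exact le_rfl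
  · have : (0 : ℝ) ≤ 1 + 1 / (N : ℝ) := by positivity
    linarith

lemma counter_nonneg {n : ℕ} (N : ℕ) (s : Fin n → ℕ → ℝ) (c : Pouring n)
    (S : ℕ → Finset (Fin n)) (t : ℕ) (j : Fin n) : 0 ≤ counter N s c S t j := by
  induction t with
  | zero => exact le_rfl
  | succ t ih =>
    have h := ih.trans (le_raise N s c t (counter N s c S t) j)
    rw [counter_succ]
    split_ifs
    · linarith [min_le_right (1 + 2 / (N : ℝ)) (raise N s c t (counter N s c S t) j)]
    · simpa using h

/-- Removals cancel because they are the same for the cup and its counter, leaving only the mismatch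
between pouring and crossing increments. -/
lemma fillLevel_eq {n : ℕ} {N : ℕ} {s : Fin n → ℕ → ℝ} {c : Pouring n}
    {S : ℕ → Finset (Fin n)} {r : ℕ → Fin n → ℝ}
    (hr : ∀ t j, r t j = if j ∈ S t then
      min (1 + 2 / (N : ℝ)) (raise N s c t (counter N s c S t) j) else 0) (t : ℕ) (j : Fin n) :
    fillLevel c r t j =
      poured c t j - (1 + 1 / (N : ℝ)) * crossCount N s c t j + counter N s c S t j := by
  induction t with
  | zero => simp [fillLevel, poured, crossCount, counter]
  | succ t ih =>
    have e : (1 + 1 / (N : ℝ)) * crossCount N s c (t + 1) j = (1 + 1 / (N : ℝ)) *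
        crossCount N s c t j + (raise N s c t (counter N s c S t) j - counter N s c S t j) := by
      rw [crossCount, Finset.sum_range_succ, raise, crossCount]
      split_ifs <;> push_cast <;> ring
    simp only [fillLevel]
    rw [ih, hr, counter_succ, poured_succ, e]
    ring

/-! ### The selection rule and the online algorithm -/

/-- Maximise the total priority over sets of the prescribed size: exchanging a selected cup for an
unselected one of higher priority would increase it. -/
lemma exists_top_priority {n : ℕ} (p : ℕ) (ρ : Fin n → Fin 3) :
    ∃ S : Finset (Fin n), S.card = min (p + 1) n ∧ ∀ i ∈ S, ∀ j ∉ S, ρ j ≤ ρ i := by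
  obtain ⟨S, hS, hmax⟩ := Finset.exists_max_image
    (Finset.powersetCard (min (p + 1) n) (Finset.univ : Finset (Fin n)))
    (fun S => ∑ i ∈ S, (ρ i : ℕ))
    (Finset.powersetCard_nonempty.2 (by simp))
  rw [Finset.mem_powersetCard] at hS
  refine ⟨S, hS.2, fun i hi j hj => ?_⟩
  have hj' : j ∉ S.erase i := fun h => hj (Finset.mem_of_mem_erase h)
  have h := hmax (insert j (S.erase i)) (by
    rw [Finset.mem_powersetCard]
    refine ⟨Finset.subset_univ _, ?_⟩
    rw [Finset.card_insert_of_notMem hj', Finset.card_erase_of_mem hi, ← hS.2]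
    have := Finset.card_pos.2 ⟨i, hi⟩
    omega)
  rw [Finset.sum_insert hj', ← Finset.add_sum_erase S _ hi] at h
  rw [Fin.le_def]
  omega

/-- The cups selected when the cups have priorities `ρ`. -/
noncomputable def pick {n : ℕ} (p : ℕ) (ρ : Fin n → Fin 3) : Finset (Fin n) :=
  (exists_top_priority p ρ).choose

open Classical in
/-- The priority of a cup whose counter is `x`. -/
noncomputable def priority (N : ℕ) (x : ℝ) : Fin 3 :=
  if 1 + 1 / (N : ℝ) ≤ x then 2 else if x ≠ 0 then 1 else 0

lemma isPrioritySelection_pick {n : ℕ} (p N : ℕ) (v : Fin n → ℝ) :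
    IsPrioritySelection p N v (pick p fun j => priority N (v j)) := by
  obtain ⟨h1, h2⟩ := (exists_top_priority p fun j => priority N (v j)).choose_spec
  have hpos : (0 : ℝ) < 1 + 1 / (N : ℝ) := by positivity
  refine ⟨h1, fun i hi j hj hv => ?_, fun i hi j hj hv => ?_⟩ <;>
  · have h := h2 i hi j hj
    simp only [priority] at h
    split_ifs at h with h3 h4 <;> simp_all <;> linarith

lemma measurable_priority (N : ℕ) : Measurable (priority N) := by
  unfold priority
  refine Measurable.ite measurableSet_Ici measurable_const
    (Measurable.ite ?_ measurable_const measurable_const)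
  exact (measurableSet_singleton (0 : ℝ)).compl

/-- The counters of the threshold-counter algorithm that breaks ties by `pick`. -/
noncomputable def algCounter {n : ℕ} (p N : ℕ) (s : Fin n → ℕ → ℝ) (c : Pouring n) :
    ℕ → Fin n → ℝ
  | 0 => fun _ => 0
  | t + 1 => fun j =>
      raise N s c t (algCounter p N s c t) j -
        if j ∈ pick p (fun i => priority N (raise N s c t (algCounter p N s c t) i)) then
          min (1 + 2 / (N : ℝ)) (raise N s c t (algCounter p N s c t) j) else 0

/-- The cups selected by the threshold-counter algorithm that breaks ties by `pick`. -/
noncomputable def algSelect {n : ℕ} (p N : ℕ) (s : Fin n → ℕ → ℝ) (c : Pouring n) (t : ℕ) :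
    Finset (Fin n) :=
  pick p fun i => priority N (raise N s c t (algCounter p N s c t) i)

/-- The amounts removed by the threshold-counter algorithm that breaks ties by `pick`. -/
noncomputable def algRemove {n : ℕ} (p N : ℕ) (s : Fin n → ℕ → ℝ) (c : Pouring n) (t : ℕ)
    (j : Fin n) : ℝ :=
  if j ∈ algSelect p N s c t then
    min (1 + 2 / (N : ℝ)) (raise N s c t (algCounter p N s c t) j) else 0

lemma counter_algSelect {n : ℕ} (p N : ℕ) (s : Fin n → ℕ → ℝ) (c : Pouring n) (t : ℕ) :
    counter N s c (algSelect p N s c) t = algCounter p N s c t := by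
  induction t with
  | zero => rfl
  | succ t ih =>
    ext j
    rw [counter_succ, ih]
    rfl

lemma algCounter_nonneg {n : ℕ} (p N : ℕ) (s : Fin n → ℕ → ℝ) (c : Pouring n) (t : ℕ)
    (j : Fin n) : 0 ≤ algCounter p N s c t j := by
  rw [← counter_algSelect]
  exact counter_nonneg N s c _ t j

lemma poured_congr {n : ℕ} {c c' : Pouring n} {t : ℕ} (h : ∀ u < t, c u = c' u) (j : Fin n) :
    poured c t j = poured c' t j :=
  Finset.sum_congr rfl fun u hu => by rw [h u (Finset.mem_range.1 hu)]

lemma raise_congr {n : ℕ} {N : ℕ} {s : Fin n → ℕ → ℝ} {c c' : Pouring n} {t : ℕ}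
    (h : ∀ u ≤ t, c u = c' u) (w : Fin n → ℝ) : raise N s c t w = raise N s c' t w := by
  ext j
  have h1 := poured_congr (t := t) (fun u hu => h u hu.le) j
  have h2 := poured_congr (t := t + 1) (fun u hu => h u (Nat.lt_succ_iff.1 hu)) j
  have : Crosses N s c t j ↔ Crosses N s c' t j := by simp only [Crosses, h1, h2]
  by_cases hX : Crosses N s c t j
  · rw [raise, raise, if_pos hX, if_pos (this.1 hX)]
  · rw [raise, raise, if_neg hX, if_neg (mt this.2 hX)]

lemma algCounter_congr {n : ℕ} {p N : ℕ} {s : Fin n → ℕ → ℝ} {c c' : Pouring n} {t : ℕ}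
    (h : ∀ u < t, c u = c' u) : algCounter p N s c t = algCounter p N s c' t := by
  induction t with
  | zero => rfl
  | succ t ih =>
    unfold algCounter
    rw [ih fun u hu => h u (hu.trans t.lt_succ_self),
      raise_congr fun u hu => h u (Nat.lt_succ_iff.2 hu)]

lemma algRemove_congr {n : ℕ} {p N : ℕ} {s : Fin n → ℕ → ℝ} {c c' : Pouring n} {t : ℕ}
    (h : ∀ u ≤ t, c u = c' u) : algRemove p N s c t = algRemove p N s c' t := by
  ext j
  unfold algRemove algSelect
  rw [algCounter_congr (p := p) (N := N) (s := s) fun u hu => h u (le_of_lt hu), raise_congr h]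

/-! ### Measurability in the random offsets -/

section Measurability

variable {Ω : Type*} [MeasurableSpace Ω] {n : ℕ} {s : Ω → Fin n → ℕ → ℝ}

lemma measurable_raise (hs : ∀ j b, Measurable fun ω => s ω j b) (N : ℕ) (c : Pouring n) (t : ℕ)
    {w : Ω → Fin n → ℝ} (hw : ∀ j, Measurable fun ω => w ω j) (j : Fin n) :
    Measurable fun ω => raise N (s ω) c t (w ω) j := by
  have hthr : ∀ b m, Measurable fun ω => threshold N (s ω) j b m := fun b m => by
    unfold threshold
    exact (hs j b).const_add _
  have hX : MeasurableSet {ω | Crosses N (s ω) c t j} := by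
    simp only [Crosses, Set.ofPred_exists, Set.ofPred_and]
    exact MeasurableSet.iUnion fun b => MeasurableSet.iUnion fun m =>
      (MeasurableSet.const _).inter ((MeasurableSet.const _).inter
        ((measurableSet_lt measurable_const (hthr b m)).inter
          (measurableSet_le (hthr b m) measurable_const)))
  unfold raise
  exact (hw j).add (Measurable.ite hX measurable_const measurable_const)

/-- Ties are broken as a function of the priority vector alone. That vector takes finitely many
values, so an arbitrary choice function causes no measurability problem. -/
lemma measurable_ite_pick (p N : ℕ) {v : Ω → Fin n → ℝ} (hv : ∀ j, Measurable fun ω => v ω j)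
    (j : Fin n) {f : Ω → ℝ} (hf : Measurable f) :
    Measurable fun ω => if j ∈ pick p (fun i => priority N (v ω i)) then f ω else 0 := by
  refine Measurable.ite ?_ hf measurable_const
  have h : Measurable fun ω => fun i => priority N (v ω i) :=
    measurable_pi_lambda _ fun i => (measurable_priority N).comp (hv i)
  exact h (Set.to_countable {ρ | j ∈ pick p ρ}).measurableSet

lemma measurable_algCounter (hs : ∀ j b, Measurable fun ω => s ω j b) (p N : ℕ) (c : Pouring n)
    (t : ℕ) (j : Fin n) : Measurable fun ω => algCounter p N (s ω) c t j := by
  induction t generalizing j with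
  | zero => exact measurable_const
  | succ t ih =>
    have hv := measurable_raise hs N c t ih
    exact (hv j).sub (measurable_ite_pick p N hv j (measurable_const.min (hv j)))

lemma measurable_algRemove (hs : ∀ j b, Measurable fun ω => s ω j b) (p N : ℕ) (c : Pouring n)
    (t : ℕ) (j : Fin n) : Measurable fun ω => algRemove p N (s ω) c t j := by
  have hv := measurable_raise hs N c t (measurable_algCounter hs p N c t)
  exact measurable_ite_pick p N hv j (measurable_const.min (hv j))

end Measurability

/-! ### The random offsets and the emptier -/

/-- The sample space of the random values of all threshold collections. -/
abbrev Seeds (n : ℕ) : Type := Fin n × ℕ → Set.Ioc (0 : ℝ) 1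

/-- The random value of the threshold collection number `b` in cup `j`. -/
def seed {n : ℕ} (ω : Seeds n) (j : Fin n) (b : ℕ) : ℝ := ω (j, b)

/-- The uniform distribution on `(0, 1]`. -/
noncomputable def uniformIoc : Measure (Set.Ioc (0 : ℝ) 1) := volume.comap Subtype.val

lemma map_uniformIoc : uniformIoc.map Subtype.val = volume.restrict (Set.Ioc (0 : ℝ) 1) :=
  map_comap_subtype_coe measurableSet_Ioc volume

instance : IsProbabilityMeasure uniformIoc := by
  have h : IsProbabilityMeasure (uniformIoc.map Subtype.val) := by
    rw [map_uniformIoc]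
    exact ⟨by simp⟩
  exact (Measure.isProbabilityMeasure_map_iff measurable_subtype_coe.aemeasurable).1 h

/-- The law of the random values: they are independent and uniform. -/
noncomputable def seedLaw (n : ℕ) : Measure (Seeds n) :=
  Measure.infinitePi fun _ => uniformIoc

instance (n : ℕ) : IsProbabilityMeasure (seedLaw n) := by
  unfold seedLaw; infer_instance

lemma measurable_seed {n : ℕ} (j : Fin n) (b : ℕ) : Measurable fun ω : Seeds n => seed ω j b :=
  measurable_subtype_coe.comp (measurable_pi_apply (j, b))

lemma seed_mem {n : ℕ} (ω : Seeds n) (j : Fin n) (b : ℕ) : seed ω j b ∈ Set.Ioc (0 : ℝ) 1 :=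
  (ω (j, b)).2

lemma map_seed {n : ℕ} (j : Fin n) (b : ℕ) :
    (seedLaw n).map (fun ω => seed ω j b) = volume.restrict (Set.Ioc (0 : ℝ) 1) := by
  have h := Measure.infinitePi_map_eval
    (fun _ : Fin n × ℕ => uniformIoc) (j, b)
  have e : (fun ω : Seeds n => seed ω j b) =
      (Subtype.val : Set.Ioc (0 : ℝ) 1 → ℝ) ∘ Function.eval (j, b) := rfl
  rw [e, ← Measure.map_map measurable_subtype_coe (measurable_pi_apply _), seedLaw]
  exact (congrArg _ h).trans map_uniformIoc

lemma iIndepFun_seed (n : ℕ) :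
    iIndepFun (fun (q : Fin n × ℕ) ω => seed ω q.1 q.2) (seedLaw n) :=
  iIndepFun_infinitePi (P := fun _ : Fin n × ℕ => uniformIoc)
    (X := fun _ => (Subtype.val : Set.Ioc (0 : ℝ) 1 → ℝ)) fun _ => measurable_subtype_coe

/-- An emptier that runs the threshold-counter algorithm with collections of size `N`. -/
noncomputable def thresholdEmptier (n p : ℕ) (ε : ℝ) {δ : ℝ} {N : ℕ} (hN : 0 < N)
    (hδ : 1 / (N : ℝ) ≤ δ) : Emptier n p ε δ where
  Ω := Seeds n
  μ := seedLaw n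
  remove ω c := algRemove p N (seed ω) c
  measurable_remove c _ t j := measurable_algRemove measurable_seed p N c t j
  online ω c c' _ _ t h := algRemove_congr h
  remove_nonneg ω c _ t j := by
    have := (algCounter_nonneg p N (seed ω) c t j).trans (le_raise N (seed ω) c t _ j)
    unfold algRemove
    split_ifs <;> positivity
  remove_le ω c _ t j := by
    have h0 : 0 < 1 / (N : ℝ) := by positivity
    have e : 2 / (N : ℝ) = 2 * (1 / N) := by ring
    unfold algRemove
    split_ifs
    · refine (min_le_left _ _).trans ?_
      rw [e]
      linarith
    · linarith
  card_le ω c _ t := by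
    have hsub : {j | algRemove p N (seed ω) c t j ≠ 0} ⊆ (algSelect p N (seed ω) c t : Set _) := by
      intro j hj
      by_contra h
      exact hj (if_neg h)
    refine (Set.ncard_le_ncard hsub (Finset.finite_toSet _)).trans ?_
    rw [Set.ncard_coe_finset]
    exact (isPrioritySelection_pick p N _).card_eq.le.trans (min_le_left _ _)
  fill_nonneg ω c hc t j := by
    rw [fillLevel_eq (N := N) (s := seed ω) (S := algSelect p N (seed ω) c)
      fun t j => by rw [counter_algSelect]; rfl]
    have := crossCount_le_poured hN (seed_mem ω) hc t j
    linarith [counter_nonneg N (seed ω) c (algSelect p N (seed ω) c) t j]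

lemma isThresholdCounter_thresholdEmptier (n p : ℕ) (ε : ℝ) {δ : ℝ} {N : ℕ} (hN : 0 < N)
    (hδ : 1 / (N : ℝ) ≤ δ) : (thresholdEmptier n p ε hN hδ).IsThresholdCounter N := by
  refine ⟨seed, fun ω => algSelect p N (seed ω), measurable_seed, seed_mem, map_seed,
    iIndepFun_seed n, fun ω c _ t => ?_⟩
  rw [counter_algSelect]
  exact ⟨isPrioritySelection_pick p N _, fun j => rfl⟩

lemma backlog_le_three {n p : ℕ} {ε δ : ℝ} {N : ℕ} (hN : 0 < N) (hδ : 1 / (N : ℝ) ≤ δ)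
    {c : Pouring n} (hc : IsLegalPouring n p ε c) {i : ℕ} {ω : Seeds n}
    (h : ∀ j, algCounter p N (seed ω) c i j = 0) :
    (thresholdEmptier n p ε hN hδ).backlog c i ω ≤ 3 := by
  -- The bound must itself be non-negative because for `n = 0` the supremum is over no cups and
  -- equals 0.
  refine Real.iSup_le (fun j => ?_) (by norm_num)
  have e := fillLevel_eq (N := N) (s := seed ω) (S := algSelect p N (seed ω) c) (c := c)
      (r := algRemove p N (seed ω) c) (fun t j => by rw [counter_algSelect]; rfl) i j
  rw [counter_algSelect, h] at e
  have := poured_le_crossCount hN (seed_mem ω) hc i j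
  change fillLevel c (algRemove p N (seed ω) c) i j ≤ 3
  linarith

/-! ### Domination of the counters by a queue -/

open Classical in
/-- The number of cups that cross a threshold in step number `t + 1`. -/
noncomputable def crossers {n : ℕ} (N : ℕ) (s : Fin n → ℕ → ℝ) (c : Pouring n) (t : ℕ) : ℕ :=
  (Finset.univ.filter fun j => Crosses N s c t j).card

/-- The number of selections needed to empty all counters. -/
noncomputable def pending {n : ℕ} (N : ℕ) (w : Fin n → ℝ) : ℕ :=
  ∑ j, ⌈w j / (1 + 2 / (N : ℝ))⌉₊

/-- A crossing adds `1 + 1 / N`, less than the `1 + 2 / N` that one selection can remove, so it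
costs at most one further selection. -/
lemma pending_raise_le {n : ℕ} (N : ℕ) (s : Fin n → ℕ → ℝ) (c : Pouring n) (t : ℕ)
    (w : Fin n → ℝ) : pending N (raise N s c t w) ≤ pending N w + crossers N s c t := by
  classical
  rw [pending, pending, crossers, Finset.card_filter, ← Finset.sum_add_distrib]
  refine Finset.sum_le_sum fun j _ => ?_
  have hD : (0 : ℝ) < 1 + 2 / (N : ℝ) := by positivity
  rw [raise]
  by_cases h : Crosses N s c t j
  · simp only [if_pos h]
    rw [Nat.ceil_le, add_div]
    push_cast
    refine add_le_add (Nat.le_ceil _) ?_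
    rw [div_le_one hD]
    gcongr
    norm_num
  · simp [h]

lemma ceil_sub_min_add_one_le {D v : ℝ} (hD : 0 < D) (hv : 0 < v) :
    ⌈(v - min D v) / D⌉₊ + 1 ≤ ⌈v / D⌉₊ := by
  have h1 : 1 ≤ ⌈v / D⌉₊ := Nat.one_le_iff_ne_zero.2 (Nat.ceil_pos.2 (by positivity)).ne'
  rw [← Nat.le_sub_iff_add_le h1, Nat.ceil_le, Nat.cast_sub h1]
  rcases le_total v D with h | h
  · rw [min_eq_right h, sub_self, zero_div]
    have : (1 : ℝ) ≤ ⌈v / D⌉₊ := by exact_mod_cast h1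
    simpa using this
  · rw [min_eq_left h, sub_div, div_self hD.ne']
    push_cast
    linarith [Nat.le_ceil (v / D)]

section

variable {n p N : ℕ} {v w' : Fin n → ℝ} {S : Finset (Fin n)}
  (hv : ∀ j, 0 ≤ v j) (hS : IsPrioritySelection p N v S)
  (hw' : ∀ j, w' j = v j - if j ∈ S then min (1 + 2 / (N : ℝ)) (v j) else 0)
include hv hw' hS

/-- Either all selected cups have non-zero counters, or all non-zero counters are selected. -/
lemma pending_remove_or :
    pending N w' + (p + 1) ≤ pending N v ∨ ∀ j, v j ≠ 0 → j ∈ S := by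
  by_cases hall : ∀ j, v j ≠ 0 → j ∈ S
  · exact Or.inr hall
  left
  push Not at hall
  obtain ⟨j0, hj0, hj0S⟩ := hall
  -- An unselected cup exists, so the minimum of `p + 1` and `n` is `p + 1`.
  have hcard : S.card = p + 1 := by
    have h1 := hS.card_eq
    have h2 : S.card < n := by
      simpa using Finset.card_lt_univ_of_notMem hj0S
    omega
  have hne : ∀ i ∈ S, 0 < v i := fun i hi =>
    lt_of_le_of_ne (hv i) (hS.nonzero_first i hi j0 hj0S hj0).symm
  have hD : (0 : ℝ) < 1 + 2 / (N : ℝ) := by positivity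
  calc pending N w' + (p + 1)
      = ∑ j, (⌈w' j / (1 + 2 / (N : ℝ))⌉₊ + if j ∈ S then 1 else 0) := by
        rw [Finset.sum_add_distrib, pending, ← hcard]
        simp
    _ ≤ pending N v := by
        refine Finset.sum_le_sum fun j _ => ?_
        rw [hw']
        split_ifs with h
        · exact ceil_sub_min_add_one_le hD (hne j h)
        · simp

end

lemma pending_eq_zero {n N : ℕ} {w : Fin n → ℝ} (hw : ∀ j, w j ≤ 0) : pending N w = 0 := by
  refine Finset.sum_eq_zero fun j _ => Nat.ceil_eq_zero.2 ?_
  exact div_nonpos_of_nonpos_of_nonneg (hw j) (by positivity)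

/-- The workload process `G (t + 1) = max 0 (G t - 1 + Y t)`. -/
noncomputable def workload (Y : ℕ → ℝ) : ℕ → ℝ
  | 0 => 0
  | t + 1 => max 0 (workload Y t - 1 + Y t)

lemma workload_nonneg (Y : ℕ → ℝ) (t : ℕ) : 0 ≤ workload Y t := by
  cases t
  · exact le_rfl
  · exact le_max_left _ _

/-- Take `t` to be the last time before `i` at which the queue was empty; since then the maximum
with 0 has not acted. -/
lemma exists_lt_sum_of_workload_pos (Y : ℕ → ℝ) {i : ℕ} (h : 0 < workload Y i) :
    ∃ t < i, workload Y i ≤ ∑ u ∈ Finset.Ico t i, (Y u - 1) := by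
  induction i with
  | zero => exact absurd h (lt_irrefl _)
  | succ i ih =>
    rw [workload] at h ⊢
    have h' : 0 < workload Y i - 1 + Y i := by
      by_contra hle
      rw [max_eq_left (not_lt.1 hle)] at h
      exact lt_irrefl _ h
    rw [max_eq_right h'.le]
    rcases (workload_nonneg Y i).eq_or_lt with h0 | h0
    · refine ⟨i, i.lt_succ_self, ?_⟩
      rw [← h0]
      simp
    · obtain ⟨t, ht, hle⟩ := ih h0
      refine ⟨t, ht.trans i.lt_succ_self, ?_⟩
      rw [Finset.sum_Ico_succ_top ht.le]
      linarith

/-- The counters are controlled by the workload process driven by the excess of the number of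
crossing cups over `p + 1 - (N + 2) / K`. -/
lemma algCounter_add_pending_le {n p N : ℕ} (hN : 0 < N) (s : Fin n → ℕ → ℝ) (c : Pouring n)
    {K : ℝ} (hK : 0 < K) {Y : ℕ → ℝ} (hY0 : ∀ t, 0 ≤ Y t) {i : ℕ}
    (hY : ∀ t < i, K * (crossers N s c t - (p + 1)) + (N + 2) ≤ Y t) (j : Fin n) :
    ∀ t ≤ i, N * algCounter p N s c t j + K * pending N (algCounter p N s c t) ≤
      workload Y t := by
  intro t
  induction t generalizing j with
  | zero =>
    intro _
    rw [pending_eq_zero (w := algCounter p N s c 0) fun j => le_rfl]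
    simp [algCounter, workload]
  | succ t ih =>
    intro ht
    have ih' := fun j => ih j (Nat.le_of_succ_le ht)
    have hYt := hY t ht
    have hN' : (0 : ℝ) < N := by exact_mod_cast hN
    set w := algCounter p N s c t with hw
    set w' := algCounter p N s c (t + 1) with hw'
    set v := raise N s c t w with hv
    have hv0 : ∀ j, 0 ≤ v j := fun j =>
      (algCounter_nonneg p N s c t j).trans (le_raise N s c t _ j)
    have hS : IsPrioritySelection p N v (algSelect p N s c t) := isPrioritySelection_pick p N _
    have hrec : ∀ j, w' j = v j - if j ∈ algSelect p N s c t then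
        min (1 + 2 / (N : ℝ)) (v j) else 0 := fun j => rfl
    have hle1 : (pending N v : ℝ) ≤ pending N w + crossers N s c t := by
      exact_mod_cast pending_raise_le N s c t w
    have hvw : ∀ j, N * v j ≤ N * w j + (N + 1) := fun j => by
      have h := mul_le_mul_of_nonneg_left (raise_le N s c t w j) hN'.le
      have e : (N : ℝ) * (w j + (1 + 1 / (N : ℝ))) = N * w j + (N + 1) := by
        field_simp
      rwa [e] at h
    rw [workload]
    rcases pending_remove_or hv0 hS hrec with hbusy | hidle
    -- Busy step: `pending` changes by at most `crossers - (p + 1)` and `N * w j` grows by at most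
    -- `N + 1`; the term `N + 2` in the bound on `Y` pays for this growth and the unit of service.
    · refine le_max_of_le_right ?_
      have h1 : (pending N w' : ℝ) + (p + 1) ≤ pending N v := by exact_mod_cast hbusy
      have h2 : w' j ≤ v j := by
        rw [hrec]
        have := hv0 j
        split_ifs
        · exact sub_le_self _ (by positivity)
        · simp
      have h3 := mul_le_mul_of_nonneg_left h2 hN'.le
      have h4 : K * pending N w' ≤ K * (pending N w + crossers N s c t - (p + 1)) :=
        mul_le_mul_of_nonneg_left (by linarith) hK.le
      nlinarith [ih' j, hvw j]
    -- Idle step: every non-zero counter is served, so one that stays positive gains at most `N + 1`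
    -- and loses `N + 2`, in units of `1 / N`.
    · have hdrop : ∀ j, 0 < w' j → N * w' j ≤ N * w j - 1 := fun j hj => by
        have hvj : v j ≠ 0 := fun h0 => by
          rw [hrec, h0] at hj
          have : (0 : ℝ) ≤ 1 + 2 / (N : ℝ) := by positivity
          simp [min_eq_right this] at hj
        have hmem := hidle j hvj
        have e := hrec j
        rw [if_pos hmem] at e
        have hlt : 1 + 2 / (N : ℝ) < v j := by
          by_contra hge
          rw [min_eq_right (not_lt.1 hge)] at e
          linarith
        rw [min_eq_left hlt.le] at e
        have e' : (N : ℝ) * w' j = N * v j - (N + 2) := by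
          rw [e]; field_simp
        linarith [hvw j]
      by_cases hall : ∀ j, w' j ≤ 0
      · refine le_max_of_le_left ?_
        rw [pending_eq_zero hall]
        simpa using mul_nonpos_of_nonneg_of_nonpos hN'.le (hall j)
      · refine le_max_of_le_right ?_
        push Not at hall
        obtain ⟨j0, hj0⟩ := hall
        have hpend : K * (pending N w' : ℝ) ≤ K * pending N w := by
          refine mul_le_mul_of_nonneg_left ?_ hK.le
          refine Nat.cast_le.2 (Finset.sum_le_sum fun j _ => Nat.ceil_le_ceil ?_)
          gcongr
          rcases le_or_gt (w' j) 0 with h | h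
          · exact h.trans (algCounter_nonneg p N s c t j)
          · have := hdrop j h
            by_contra hcon
            nlinarith
        have h0 := hdrop j0 hj0
        have hpos : 0 < N * w' j0 := mul_pos hN' hj0
        -- If the counter of `j` is cleared, the unit decrease comes from `j0`: it stays positive,
        -- so `N * w j0` exceeded 1 while `pending` did not grow.
        rcases le_or_gt (w' j) 0 with h | h
        · have := mul_nonpos_of_nonneg_of_nonpos hN'.le h
          linarith [ih' j0, hY0 t]
        · linarith [ih' j, hdrop j h, hY0 t]

/-- If some counter is non-zero after `i` steps, the driving process has been large on average
over some time window ending there. -/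
lemma exists_window_of_algCounter_ne_zero {n p N : ℕ} (hN : 0 < N) (s : Fin n → ℕ → ℝ)
    (c : Pouring n) {K : ℝ} (hK : 0 < K) {Y : ℕ → ℝ} (hY0 : ∀ t, 0 ≤ Y t) {i : ℕ}
    (hY : ∀ t < i, K * (crossers N s c t - (p + 1)) + (N + 2) ≤ Y t) {j : Fin n}
    (hj : algCounter p N s c i j ≠ 0) :
    ∃ t < i, ((i - t : ℕ) : ℝ) < ∑ u ∈ Finset.Ico t i, Y u := by
  have hN' : (0 : ℝ) < N := by exact_mod_cast hN
  have h1 := algCounter_add_pending_le hN s c hK hY0 hY j i le_rfl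
  have h2 : 0 < N * algCounter p N s c i j :=
    mul_pos hN' (lt_of_le_of_ne (algCounter_nonneg p N s c i j) hj.symm)
  have h3 : 0 ≤ K * pending N (algCounter p N s c i) := by positivity
  have h4 : 0 < workload Y i := by linarith
  obtain ⟨t, ht, hle⟩ := exists_lt_sum_of_workload_pos Y h4
  refine ⟨t, ht, ?_⟩
  rw [Finset.sum_sub_distrib] at hle
  simp only [Finset.sum_const, Nat.card_Ico, nsmul_eq_mul, mul_one] at hle
  linarith

/-! ### An Efron–Stein inequality -/

/-- Total variance: for fixed `y` the variance in `x` is at most the second moment about the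
reference value `f (x₀, y)`, hence at most the mean of `g ^ 2`. The other term is the variance of
the average over `x`. Comparing with a fixed point, not an independent copy, makes the sensitivity
depend on `x` alone. -/
lemma variance_prod_le {α β : Type*} [MeasurableSpace α] [MeasurableSpace β] {μ : Measure α}
    {ν : Measure β} [IsProbabilityMeasure μ] [IsProbabilityMeasure ν] {f : α × β → ℝ}
    (hf : Measurable f) {M : ℝ} (hM : ∀ z, |f z| ≤ M) (x₀ : α) {g : α → ℝ} (hg : Measurable g)
    {G : ℝ} (hG : ∀ x, |g x| ≤ G) (h : ∀ x y, |f (x, y) - f (x₀, y)| ≤ g x) :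
    Var[f; μ.prod ν] ≤ ∫ x, g x ^ 2 ∂μ + Var[fun y => ∫ x, f (x, y) ∂μ; ν] := by
  have hMnorm : ∀ z, ‖f z‖ ≤ M := hM
  have hfL : MemLp f 2 (μ.prod ν) :=
    MemLp.of_bound hf.aestronglyMeasurable M (Filter.Eventually.of_forall hMnorm)
  have hsec : ∀ y, MemLp (fun x => f (x, y)) 2 μ := fun y =>
    MemLp.of_bound (hf.comp measurable_prodMk_right).aestronglyMeasurable M
      (Filter.Eventually.of_forall fun x => hMnorm _)
  have hFm : StronglyMeasurable fun y => ∫ x, f (x, y) ∂μ :=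
    hf.stronglyMeasurable.integral_prod_left'
  have hFL : MemLp (fun y => ∫ x, f (x, y) ∂μ) 2 ν :=
    MemLp.of_bound hFm.aestronglyMeasurable M (Filter.Eventually.of_forall fun y => by
      simpa using norm_integral_le_of_norm_le_const (μ := μ)
        (Filter.Eventually.of_forall fun x => hMnorm (x, y)))
  have hgL : MemLp g 2 μ :=
    MemLp.of_bound hg.aestronglyMeasurable G (Filter.Eventually.of_forall hG)
  have hstep : ∀ y, ∫ x, f (x, y) ^ 2 ∂μ ≤ (∫ x, f (x, y) ∂μ) ^ 2 + ∫ x, g x ^ 2 ∂μ := fun y => by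
    have h1 := variance_eq_sub (hsec y)
    rw [← variance_sub_const (hsec y).aestronglyMeasurable (f (x₀, y))] at h1
    have h2 := variance_le_expectation_sq (μ := μ) (X := fun x => f (x, y) - f (x₀, y))
      ((hsec y).aestronglyMeasurable.sub aestronglyMeasurable_const)
    have h3 : ∫ x, (f (x, y) - f (x₀, y)) ^ 2 ∂μ ≤ ∫ x, g x ^ 2 ∂μ := by
      refine integral_mono ((hsec y).sub (memLp_const _)).integrable_sq hgL.integrable_sq
        fun x => ?_
      exact sq_le_sq' (by linarith [abs_le.1 (h x y)]) (abs_le.1 (h x y)).2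
    simp only [Pi.pow_apply] at h1 h2
    linarith
  rw [variance_eq_sub hfL, variance_eq_sub hFL]
  have e1 : ∫ z, f z ∂μ.prod ν = ∫ y, ∫ x, f (x, y) ∂μ ∂ν :=
    integral_prod_symm f (hfL.integrable one_le_two)
  have e2 : ∫ z, f z ^ 2 ∂μ.prod ν = ∫ y, ∫ x, f (x, y) ^ 2 ∂μ ∂ν :=
    integral_prod_symm (fun z => f z ^ 2) hfL.integrable_sq
  have e3 : ∫ y, ∫ x, f (x, y) ^ 2 ∂μ ∂ν ≤
      ∫ y, ((∫ x, f (x, y) ∂μ) ^ 2 + ∫ x, g x ^ 2 ∂μ) ∂ν :=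
    integral_mono hfL.integrable_sq.integral_prod_right
      (hFL.integrable_sq.add (integrable_const _)) hstep
  rw [integral_add hFL.integrable_sq (integrable_const _), integral_const] at e3
  simp only [Pi.pow_apply, probReal_univ, one_smul] at e3 ⊢
  rw [e1, e2]
  linarith

/-- An Efron–Stein inequality: the variance of a function of independent random variables is at
most the sum of the mean squares of its sensitivities to the single variables. -/
lemma variance_pi_le {m : ℕ} {ν : Fin m → Measure ℝ} [∀ q, IsProbabilityMeasure (ν q)]
    {f : (Fin m → ℝ) → ℝ} (hf : Measurable f) {M : ℝ} (hM : ∀ x, |f x| ≤ M) (x₀ : Fin m → ℝ)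
    {g : Fin m → ℝ → ℝ} (hg : ∀ q, Measurable (g q)) {G : ℝ} (hG : ∀ q x, |g q x| ≤ G)
    (h : ∀ x q, |f x - f (Function.update x q (x₀ q))| ≤ g q (x q)) :
    Var[f; Measure.pi ν] ≤ ∑ q, ∫ x, g q x ^ 2 ∂ν q := by
  induction m with
  | zero =>
    have hconst : f = fun _ => f x₀ := funext fun x => congrArg f (Subsingleton.elim x x₀)
    have h1 := variance_sub_const (μ := Measure.pi ν) hf.aestronglyMeasurable (f x₀)
    have h2 : (fun x => f x - f x₀) = 0 := funext fun x => by
      rw [hconst]; simp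
    rw [h2, variance_zero] at h1
    simp [← h1]
  | succ m ih =>
    have hmp := (measurePreserving_piFinSuccAbove ν 0).symm
    set e := MeasurableEquiv.piFinSuccAbove (fun _ : Fin (m + 1) => ℝ) 0 with he
    have happ : ∀ z, e.symm z = Fin.cons z.1 z.2 := fun z => by
      simp [he, MeasurableEquiv.piFinSuccAbove, Fin.insertNthEquiv]
    have hmeas : Measurable fun z => f (e.symm z) := hf.comp e.symm.measurable
    rw [← hmp.variance_fun_comp hf.aemeasurable]
    have h0 := variance_prod_le (μ := ν 0) (ν := Measure.pi fun q => ν (Fin.succAbove 0 q))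
      hmeas (fun z => hM _) (x₀ 0) (hg 0) (hG 0) (fun x y => by
        have := h (Fin.cons x y) 0
        simpa [happ] using this)
    refine h0.trans ?_
    rw [Fin.sum_univ_succ]
    refine add_le_add le_rfl ?_
    have hint : ∀ y, Integrable (fun x => f (e.symm (x, y))) (ν 0) := fun y =>
      Integrable.of_bound (hmeas.comp measurable_prodMk_right).aestronglyMeasurable M
        (Filter.Eventually.of_forall fun x => hM _)
    -- Averaging out the first coordinate preserves the sensitivity bounds in the others, so the
    -- induction hypothesis applies to the average.
    refine ih (ν := fun q => ν (Fin.succAbove 0 q)) (f := fun y => ∫ x, f (e.symm (x, y)) ∂ν 0)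
      hmeas.stronglyMeasurable.integral_prod_left'.measurable (fun y => ?_)
      (fun q => x₀ q.succ) (fun q => hg q.succ) (fun q => hG q.succ) (fun y q => ?_)
    · simpa using norm_integral_le_of_norm_le_const (μ := ν 0) (C := M)
        (f := fun x => f (e.symm (x, y))) (Filter.Eventually.of_forall fun x => hM _)
    · rw [← integral_sub (hint _) (hint _)]
      have := norm_integral_le_of_norm_le_const (μ := ν 0) (C := g q.succ (y q))
        (f := fun x => f (e.symm (x, y)) - f (e.symm (x, Function.update y q (x₀ q.succ))))
        (Filter.Eventually.of_forall fun x => by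
          have := h (Fin.cons x y) q.succ
          rw [← Fin.cons_update] at this
          simpa [happ] using this)
      simpa using this

/-- By independence the joint law is a product measure; after reindexing by `Fin` the inequality is
transported along it. -/
lemma iIndepFun_variance_le {ι Ω : Type*} [Fintype ι] [DecidableEq ι] [MeasurableSpace Ω]
    {μ : Measure Ω} [IsProbabilityMeasure μ] {X : ι → Ω → ℝ} (hX : ∀ q, Measurable (X q))
    (hind : iIndepFun X μ) {f : (ι → ℝ) → ℝ} (hf : Measurable f) {M : ℝ}
    (hM : ∀ x, |f x| ≤ M) (x₀ : ι → ℝ) {g : ι → ℝ → ℝ} (hg : ∀ q, Measurable (g q)) {G : ℝ}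
    (hG : ∀ q x, |g q x| ≤ G)
    (h : ∀ x q, |f x - f (Function.update x q (x₀ q))| ≤ g q (x q)) :
    Var[fun ω => f fun q => X q ω; μ] ≤ ∑ q, ∫ ω, g q (X q ω) ^ 2 ∂μ := by
  let e := (Fintype.equivFin ι).symm
  have hprob : ∀ k, IsProbabilityMeasure (μ.map (X (e k))) := fun k =>
    Measure.isProbabilityMeasure_map (hX _).aemeasurable
  have hind' := hind.precomp e.injective
  have hlaw := (iIndepFun_iff_map_fun_eq_pi_map (fun k => (hX (e k)).aemeasurable)).1 hind'
  have hre : Measurable fun x : Fin (Fintype.card ι) → ℝ => fun q => x (e.symm q) :=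
    measurable_pi_lambda _ fun q => measurable_pi_apply _
  have hmain := variance_pi_le (ν := fun k => μ.map (X (e k)))
    (f := fun x => f fun q => x (e.symm q)) (hf.comp hre) (fun x => hM _) (fun k => x₀ (e k))
    (fun k => hg (e k)) (fun k => hG (e k)) (fun x k => by
      have := h (fun q => x (e.symm q)) (e k)
      convert this using 4
      · ext q
        by_cases hq : q = e k
        · subst hq; simp
        · have : e.symm q ≠ k := fun h => hq (by simp [← h])
          simp [hq, this]
      · simp)
  have hvar := variance_map (μ := μ) (X := fun x : Fin (Fintype.card ι) → ℝ =>
    f fun q => x (e.symm q)) (Y := fun ω k => X (e k) ω) (hf.comp hre).aemeasurable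
    (measurable_pi_lambda _ fun k => hX (e k)).aemeasurable
  rw [← hlaw, hvar] at hmain
  have e1 : (fun x : Fin (Fintype.card ι) → ℝ => f fun q => x (e.symm q)) ∘
      (fun ω k => X (e k) ω) = fun ω => f fun q => X q ω := by
    ext ω; simp
  rw [e1] at hmain
  refine hmain.trans_eq ?_
  rw [← e.sum_comp]
  refine Finset.sum_congr rfl fun k _ => ?_
  exact integral_map (hX _).aemeasurable ((hg _).pow_const 2).aestronglyMeasurable

/-! ### Expected number of crossings -/

open Classical in
/-- The number of thresholds of the collection number `b` in cup `j` that are crossed in step number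
`u + 1`, as a function of the random value `x` of the collection. -/
noncomputable def hit {n : ℕ} (N : ℕ) (c : Pouring n) (u : ℕ) (j : Fin n) (b : ℕ) (x : ℝ) : ℝ :=
  ∑ m ∈ Finset.Icc 1 N,
    if (b : ℝ) * (N + 1) + 1 + m + x ∈ Set.Ioc (poured c u j) (poured c (u + 1) j) then 1 else 0

lemma hit_nonneg {n : ℕ} (N : ℕ) (c : Pouring n) (u : ℕ) (j : Fin n) (b : ℕ) (x : ℝ) :
    0 ≤ hit N c u j b x :=
  Finset.sum_nonneg fun m _ => by split_ifs <;> norm_num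

lemma measurable_hit {n : ℕ} (N : ℕ) (c : Pouring n) (u : ℕ) (j : Fin n) (b : ℕ) :
    Measurable (hit N c u j b) := by
  unfold hit
  refine Finset.measurable_sum _ fun m _ => ?_
  refine Measurable.ite ?_ measurable_const measurable_const
  exact (measurable_const_add _) measurableSet_Ioc

section

variable {n p : ℕ} {ε : ℝ} {c : Pouring n} (hc : IsLegalPouring n p ε c)
include hc

/-- Thresholds of a collection differ by integers, while the half-open interval poured in a step has
length at most 1. -/
lemma hit_le_one (N : ℕ) (u : ℕ) (j : Fin n) (b : ℕ) (x : ℝ) : hit N c u j b x ≤ 1 := by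
  classical
  have h1 : poured c (u + 1) j ≤ poured c u j + 1 := by
    rw [poured_succ]; linarith [hc.le_one u j]
  unfold hit
  rw [Finset.sum_boole]
  refine Nat.cast_le_one.2 (Finset.card_le_one.2 fun m hm m' hm' => ?_)
  simp only [Finset.mem_filter, Set.mem_Ioc] at hm hm'
  by_contra hne
  rcases Nat.lt_or_gt_of_ne hne with h | h
  · have : (m : ℝ) + 1 ≤ m' := by exact_mod_cast h
    linarith [hm.2.1, hm'.2.2]
  · have : (m' : ℝ) + 1 ≤ m := by exact_mod_cast h
    linarith [hm.2.2, hm'.2.1]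

/-- The intervals poured in different steps are disjoint, so each of the `N` thresholds is counted
at most once. -/
lemma sum_hit_le (N : ℕ) (U : Finset ℕ) (j : Fin n) (b : ℕ) (x : ℝ) :
    ∑ u ∈ U, hit N c u j b x ≤ N := by
  classical
  unfold hit
  rw [Finset.sum_comm]
  refine (Finset.sum_le_sum (g := fun _ => (1 : ℝ)) fun m _ => ?_).trans (by simp)
  rw [Finset.sum_boole]
  refine Nat.cast_le_one.2 (Finset.card_le_one.2 fun u hu u' hu' => ?_)
  simp only [Finset.mem_filter, Set.mem_Ioc] at hu hu'
  by_contra hne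
  rcases Nat.lt_or_gt_of_ne hne with h | h
  · linarith [hc.poured_mono j (Nat.succ_le_of_lt h), hu.2.2, hu'.2.1]
  · linarith [hc.poured_mono j (Nat.succ_le_of_lt h), hu'.2.2, hu.2.1]

/-- This artificial offset moves the whole collection to positions at most 0, where nothing is
crossed. It is the reference point for Efron–Stein, so that the sensitivity to a collection is just
its number of hits. -/
lemma hit_eq_zero (N : ℕ) (u : ℕ) (j : Fin n) (b : ℕ) :
    hit N c u j b (-((b : ℝ) * (N + 1) + 1 + N)) = 0 := by
  refine Finset.sum_eq_zero fun m hm => if_neg fun h => ?_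
  have h1 : (m : ℝ) ≤ N := by exact_mod_cast (Finset.mem_Icc.1 hm).2
  linarith [h.1, hc.poured_nonneg u j]

/-- Collection `b` lies above level `b`, and at most `i` units have been poured into a cup by then;
finitely many collections therefore suffice. -/
lemma crossers_le (N : ℕ) (s : Fin n → ℕ → ℝ) (hs : ∀ j b, s j b ∈ Set.Ioc (0 : ℝ) 1) {t i : ℕ}
    (ht : t < i) :
    (crossers N s c t : ℝ) ≤ ∑ q : Fin n × Fin i, hit N c t q.1 q.2 (s q.1 q.2) := by
  classical
  rw [crossers, Finset.card_filter, Fintype.sum_prod_type]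
  push_cast
  refine Finset.sum_le_sum fun j _ => ?_
  split_ifs with h
  · obtain ⟨b, m, h1, h2, h3, h4⟩ := h
    have hb : b < i := by
      have hs0 := (hs j b).1
      have h5 := h4.trans (hc.poured_le (t + 1) j)
      unfold threshold at h5
      have h6 : (0 : ℝ) ≤ b * N := by positivity
      have h7 : ((t + 1 : ℕ) : ℝ) ≤ i := by exact_mod_cast ht
      have h8 : (0 : ℝ) ≤ m := by positivity
      have : (b : ℝ) < i := by nlinarith
      exact_mod_cast this
    refine le_trans ?_ (Finset.single_le_sum (f := fun b : Fin i => hit N c t j b (s j b))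
      (fun b _ => hit_nonneg N c t j b _) (Finset.mem_univ ⟨b, hb⟩))
    unfold hit
    refine le_trans ?_ (Finset.single_le_sum (f := fun m : ℕ => if
      (b : ℝ) * (N + 1) + 1 + m + s j b ∈ Set.Ioc (poured c t j) (poured c (t + 1) j)
      then (1 : ℝ) else 0) (fun m _ => by split_ifs <;> norm_num) (Finset.mem_Icc.2 ⟨h1, h2⟩))
    rw [if_pos]
    exact ⟨h3, h4⟩
  · exact Finset.sum_nonneg fun b _ => hit_nonneg N c t j b _

lemma integrable_hit (N u : ℕ) (j : Fin n) (b : ℕ) :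
    Integrable (fun ω => hit N c u j b (seed ω j b)) (seedLaw n) :=
  Integrable.of_bound ((measurable_hit N c u j b).comp (measurable_seed j b)).aestronglyMeasurable
    1 (Filter.Eventually.of_forall fun ω => by
      rw [Real.norm_eq_abs, abs_of_nonneg (hit_nonneg N c u j b _)]
      exact hit_le_one hc N u j b _)

omit hc in
lemma integral_hit (N u : ℕ) (j : Fin n) (b : ℕ) :
    ∫ ω, hit N c u j b (seed ω j b) ∂seedLaw n = ∑ m ∈ Finset.Icc 1 N,
      (volume.restrict (Set.Ioc (poured c u j) (poured c (u + 1) j))).real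
        (Set.Ioc ((b : ℝ) * (N + 1) + 1 + m) ((b : ℝ) * (N + 1) + 1 + m + 1)) := by
  classical
  rw [← integral_map (f := hit N c u j b) (measurable_seed j b).aemeasurable
    (measurable_hit N c u j b).aestronglyMeasurable, map_seed]
  unfold hit
  have hms : ∀ r : ℝ, MeasurableSet ((fun x => r + x) ⁻¹'
      Set.Ioc (poured c u j) (poured c (u + 1) j)) := fun r =>
    (measurable_const_add r) measurableSet_Ioc
  have e : ∀ r x : ℝ, (if r + x ∈ Set.Ioc (poured c u j) (poured c (u + 1) j) then (1 : ℝ)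
      else 0) = ((fun x => r + x) ⁻¹' Set.Ioc (poured c u j) (poured c (u + 1) j)).indicator
        (fun _ => 1) x := fun r x => by
    simp only [Set.indicator_apply, Set.mem_preimage]
  simp only [e]
  rw [integral_finsetSum _ fun m _ => (integrable_const _).indicator (hms _)]
  refine Finset.sum_congr rfl fun m _ => ?_
  rw [integral_indicator_const _ (hms _), smul_eq_mul, mul_one, measureReal_restrict_apply (hms _),
    measureReal_restrict_apply measurableSet_Ioc]
  set r : ℝ := (b : ℝ) * (N + 1) + 1 + m with hr
  -- The threshold `r + s` is uniform in `(r, r + 1]`, so translation turns the crossing probability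
  -- into the length of an intersection.
  have e2 : (fun x => r + x) ⁻¹' Set.Ioc (poured c u j) (poured c (u + 1) j) ∩ Set.Ioc 0 1 =
      (fun x => r + x) ⁻¹' (Set.Ioc r (r + 1) ∩ Set.Ioc (poured c u j) (poured c (u + 1) j)) := by
    ext x
    simp only [Set.mem_inter_iff, Set.mem_preimage, Set.mem_Ioc]
    constructor <;> rintro ⟨⟨h1, h2⟩, h3, h4⟩ <;> refine ⟨⟨?_, ?_⟩, ?_, ?_⟩ <;> linarith
  rw [e2, measureReal_def, measureReal_def, measure_preimage_add]

lemma sum_integral_hit_le (N u i : ℕ) (j : Fin n) :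
    ∑ b : Fin i, ∫ ω, hit N c u j b (seed ω j b) ∂seedLaw n ≤ c u j := by
  simp only [integral_hit]
  set ν := volume.restrict (Set.Ioc (poured c u j) (poured c (u + 1) j)) with hν
  rw [← Finset.sum_product' (Finset.univ : Finset (Fin i)) (Finset.Icc 1 N) fun b m =>
    ν.real (Set.Ioc (((b : ℕ) : ℝ) * (N + 1) + 1 + m) (((b : ℕ) : ℝ) * (N + 1) + 1 + m + 1))]
  have hdisj : Set.PairwiseDisjoint
      (↑((Finset.univ : Finset (Fin i)) ×ˢ Finset.Icc 1 N) : Set (Fin i × ℕ)) fun q =>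
      Set.Ioc (((q.1 : ℕ) : ℝ) * (N + 1) + 1 + q.2) (((q.1 : ℕ) : ℝ) * (N + 1) + 1 + q.2 + 1) := by
    rintro ⟨b, m⟩ hq ⟨b', m'⟩ hq' hne
    simp only [Finset.coe_product, Set.mem_prod, Finset.mem_coe, Finset.mem_Icc] at hq hq'
    refine Set.disjoint_left.2 fun x hx hx' => hne ?_
    simp only [Set.mem_Ioc] at hx hx'
    -- Overlapping unit intervals with integer endpoints coincide; as `m ≤ N`, division by `N + 1`
    -- recovers both `b` and `m`.
    have h1 : (b : ℕ) * (N + 1) + 1 + m < b' * (N + 1) + 1 + m' + 1 := by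
      have : ((b : ℕ) : ℝ) * (N + 1) + 1 + m < (b' : ℕ) * (N + 1) + 1 + m' + 1 := by linarith
      exact_mod_cast this
    have h2 : (b' : ℕ) * (N + 1) + 1 + m' < b * (N + 1) + 1 + m + 1 := by
      have : ((b' : ℕ) : ℝ) * (N + 1) + 1 + m' < (b : ℕ) * (N + 1) + 1 + m + 1 := by linarith
      exact_mod_cast this
    have h3 : m + (N + 1) * (b : ℕ) = m' + (N + 1) * b' := by
      rw [mul_comm (N + 1) (b : ℕ), mul_comm (N + 1) (b' : ℕ)]; omega
    have h4 := congrArg (· % (N + 1)) h3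
    have h5 := congrArg (· / (N + 1)) h3
    simp only [Nat.add_mul_mod_self_left, Nat.mod_eq_of_lt (by omega : m < N + 1),
      Nat.mod_eq_of_lt (by omega : m' < N + 1)] at h4
    simp only [Nat.add_mul_div_left _ _ (by omega : 0 < N + 1),
      Nat.div_eq_of_lt (by omega : m < N + 1),
      Nat.div_eq_of_lt (by omega : m' < N + 1), zero_add] at h5
    exact Prod.ext (Fin.ext h5) h4
  have hfin : IsFiniteMeasure ν := ⟨by rw [hν]; simp⟩
  rw [← measureReal_biUnion_finset hdisj fun q _ => measurableSet_Ioc]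
  refine (measureReal_mono (Set.subset_univ _)).trans ?_
  rw [hν, measureReal_restrict_apply_univ, Real.volume_real_Ioc, poured_succ]
  simp [hc.nonneg u j]

lemma sum_integral_hit_le_mul (N u i : ℕ) :
    ∑ q : Fin n × Fin i, ∫ ω, hit N c u q.1 q.2 (seed ω q.1 q.2) ∂seedLaw n ≤ (1 - ε) * p := by
  rw [Fintype.sum_prod_type]
  exact (Finset.sum_le_sum fun j _ => sum_integral_hit_le hc N u i j).trans (hc.sum_le u)

end

/-! ### Concentration of load and excess -/

/-- The number of thresholds, in the first `i` collections of each cup, crossed in step number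
`u + 1`. -/
noncomputable def load {n : ℕ} (N : ℕ) (c : Pouring n) (i u : ℕ) (x : Fin n × Fin i → ℝ) : ℝ :=
  ∑ q : Fin n × Fin i, hit N c u q.1 q.2 (x q)

/-- The random values of the first `i` collections of each cup. -/
def seeds {n : ℕ} (i : ℕ) (ω : Seeds n) (q : Fin n × Fin i) : ℝ := seed ω q.1 q.2

/-- The excess of the number of crossed thresholds over `θ`. -/
noncomputable def excess {n : ℕ} (N : ℕ) (c : Pouring n) (θ : ℝ) (i u : ℕ)
    (x : Fin n × Fin i → ℝ) : ℝ :=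
  max (load N c i u x - θ) 0

lemma excess_nonneg {n : ℕ} (N : ℕ) (c : Pouring n) (θ : ℝ) (i u : ℕ) (x : Fin n × Fin i → ℝ) :
    0 ≤ excess N c θ i u x := le_max_right _ _

lemma measurable_load {n : ℕ} (N : ℕ) (c : Pouring n) (i u : ℕ) :
    Measurable (load N c i u) :=
  Finset.measurable_sum _ fun q _ => (measurable_hit N c u q.1 q.2).comp (measurable_pi_apply q)

lemma measurable_excess {n : ℕ} (N : ℕ) (c : Pouring n) (θ : ℝ) (i u : ℕ) :
    Measurable (excess N c θ i u) :=
  ((measurable_load N c i u).sub_const θ).max measurable_const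

lemma measurable_seeds {n : ℕ} (i : ℕ) : Measurable (seeds i : Seeds n → Fin n × Fin i → ℝ) :=
  measurable_pi_lambda _ fun q => measurable_seed q.1 q.2

lemma iIndepFun_seeds (n i : ℕ) :
    iIndepFun (fun (q : Fin n × Fin i) ω => seeds i ω q) (seedLaw n) :=
  (iIndepFun_seed n).precomp (g := fun q : Fin n × Fin i => (q.1, (q.2 : ℕ)))
    fun _ _ h => Prod.ext (Prod.mk.inj h).1 (Fin.ext (Prod.mk.inj h).2)

section

variable {n p : ℕ} {ε : ℝ} {c : Pouring n} (hc : IsLegalPouring n p ε c)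
include hc

lemma abs_load_le (N i u : ℕ) (x : Fin n × Fin i → ℝ) :
    |load N c i u x| ≤ Fintype.card (Fin n × Fin i) := by
  rw [load, abs_of_nonneg (Finset.sum_nonneg fun q _ => hit_nonneg N c u _ _ _)]
  exact (Finset.sum_le_sum fun q _ => hit_le_one hc N u _ _ _).trans (by simp)

lemma abs_excess_le (N : ℕ) (θ : ℝ) (i u : ℕ) (x : Fin n × Fin i → ℝ) :
    |excess N c θ i u x| ≤ Fintype.card (Fin n × Fin i) + |θ| := by
  rw [abs_of_nonneg (excess_nonneg N c θ i u x)]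
  refine max_le ?_ (by positivity)
  linarith [(abs_le.1 (abs_load_le hc N i u x)).2, neg_abs_le θ]

lemma memLp_sum_excess (N : ℕ) (θ : ℝ) (i : ℕ) (U : Finset ℕ) :
    MemLp (fun ω => ∑ u ∈ U, excess N c θ i u (seeds i ω)) 2 (seedLaw n) :=
  memLp_finsetSum _ fun u _ => MemLp.of_bound
    ((measurable_excess N c θ i u).comp (measurable_seeds i)).aestronglyMeasurable _
    (Filter.Eventually.of_forall fun _ => abs_excess_le hc N θ i u _)

/-- Poisson-type bound: hits lie in `[0, 1]`, so convexity gives `exp (t h) ≤ 1 + (exp t - 1) h`;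
independence multiplies the factors, and only the total mean `(1 - ε) p` enters. -/
lemma mgf_load_le (N i u : ℕ) {t : ℝ} (ht : 0 ≤ t) :
    mgf (fun ω => load N c i u (seeds i ω)) (seedLaw n) t ≤
      Real.exp ((Real.exp t - 1) * ((1 - ε) * p)) := by
  have hind := (iIndepFun_seeds n i).comp (fun q => hit N c u q.1 q.2)
    fun q => measurable_hit N c u q.1 q.2
  have hsum : (fun ω => load N c i u (seeds i ω)) = ∑ q : Fin n × Fin i,
      hit N c u q.1 q.2 ∘ fun ω => seeds i ω q := by
    ext ω; simp [load]
  rw [hsum, hind.mgf_sum fun q => (measurable_hit N c u q.1 q.2).comp (measurable_seed q.1 q.2)]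
  have ht' : 0 ≤ Real.exp t - 1 := by linarith [Real.one_le_exp ht]
  calc ∏ q : Fin n × Fin i, mgf (hit N c u q.1 q.2 ∘ fun ω => seeds i ω q) (seedLaw n) t
      ≤ ∏ q : Fin n × Fin i, Real.exp ((Real.exp t - 1) *
          ∫ ω, hit N c u q.1 q.2 (seed ω q.1 q.2) ∂seedLaw n) := by
        refine Finset.prod_le_prod (fun q _ => mgf_nonneg) fun q _ => ?_
        have hI := integrable_hit hc N u q.1 q.2
        calc mgf (hit N c u q.1 q.2 ∘ fun ω => seeds i ω q) (seedLaw n) t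
            ≤ ∫ ω, (1 + (Real.exp t - 1) * hit N c u q.1 q.2 (seed ω q.1 q.2)) ∂seedLaw n := by
              refine integral_mono_of_nonneg (Filter.Eventually.of_forall fun ω => by
                exact (Real.exp_pos _).le) ((integrable_const _).add (hI.const_mul _))
                (Filter.Eventually.of_forall fun ω => ?_)
              have h0 := hit_nonneg N c u q.1 q.2 (seed ω q.1 q.2)
              have h1 := hit_le_one hc N u q.1 q.2 (seed ω q.1 q.2)
              have := convexOn_exp.2 (Set.mem_univ 0) (Set.mem_univ t) (sub_nonneg.2 h1) h0
                (by ring)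
              simp only [smul_eq_mul, mul_zero, zero_add, Real.exp_zero] at this
              simp only [Function.comp_apply, seeds]
              rw [mul_comm t]
              linarith
          _ = 1 + (Real.exp t - 1) * ∫ ω, hit N c u q.1 q.2 (seed ω q.1 q.2) ∂seedLaw n := by
              rw [integral_add (integrable_const _) (hI.const_mul _), integral_const_mul]
              simp
          _ ≤ _ := by linarith [Real.add_one_le_exp ((Real.exp t - 1) *
              ∫ ω, hit N c u q.1 q.2 (seed ω q.1 q.2) ∂seedLaw n)]
    _ ≤ _ := by
        rw [← Real.exp_sum, ← Finset.mul_sum]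
        exact Real.exp_le_exp.2 (mul_le_mul_of_nonneg_left (sum_integral_hit_le_mul hc N u i) ht')

lemma integrable_exp_load (N i u : ℕ) (t θ : ℝ) :
    Integrable (fun ω => Real.exp (t * (load N c i u (seeds i ω) - θ))) (seedLaw n) := by
  refine Integrable.of_bound ((((measurable_load N c i u).comp
    (measurable_seeds i)).sub_const θ).const_mul t).exp.aestronglyMeasurable
    (Real.exp (|t| * (Fintype.card (Fin n × Fin i) + |θ|)))
    (Filter.Eventually.of_forall fun ω => ?_)
  rw [Real.norm_eq_abs, Real.abs_exp]
  refine Real.exp_le_exp.2 ((le_abs_self _).trans ?_)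
  rw [abs_mul]
  refine mul_le_mul_of_nonneg_left ((abs_sub _ _).trans ?_) (abs_nonneg _)
  linarith [abs_load_le hc N i u (seeds i ω)]

lemma integral_exp_load_le (hε : 0 < ε) (hε1 : ε ≤ 1) (N i u : ℕ) :
    ∫ ω, Real.exp (ε / 4 * (load N c i u (seeds i ω) - (1 - ε / 2) * p)) ∂seedLaw n ≤
      Real.exp (-(ε ^ 2 * p / 16)) := by
  have e : ∀ ω : Seeds n, Real.exp (ε / 4 * (load N c i u (seeds i ω) - (1 - ε / 2) * p)) =
      Real.exp (ε / 4 * load N c i u (seeds i ω)) * Real.exp (-(ε / 4 * ((1 - ε / 2) * p))) :=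
    fun ω => by rw [← Real.exp_add]; ring_nf
  simp only [e]
  rw [integral_mul_const]
  refine (mul_le_mul_of_nonneg_right (mgf_load_le hc N i u (t := ε / 4) (by positivity))
    (Real.exp_pos _).le).trans ?_
  rw [← Real.exp_add]
  refine Real.exp_le_exp.2 ?_
  have h1 := (abs_le.1 (Real.abs_exp_sub_one_sub_id_le (x := ε / 4)
    (by rw [abs_of_pos (by positivity)]; linarith))).2
  have h2 : (Real.exp (ε / 4) - 1) * ((1 - ε) * p) ≤ (ε / 4 + (ε / 4) ^ 2) * ((1 - ε) * p) :=
    mul_le_mul_of_nonneg_right (by linarith) (mul_nonneg (by linarith) (Nat.cast_nonneg p))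
  have h3 : 0 ≤ ε ^ 3 * (p : ℝ) := by positivity
  nlinarith

lemma measureReal_excess_pos_le (hε : 0 < ε) (hε1 : ε ≤ 1) (N i u : ℕ) :
    (seedLaw n).real {ω | 0 < excess N c ((1 - ε / 2) * p) i u (seeds i ω)} ≤
      Real.exp (-(ε ^ 2 * p / 16)) := by
  have h := mul_meas_ge_le_integral_of_nonneg
    (Filter.Eventually.of_forall fun ω => (Real.exp_pos _).le)
    (integrable_exp_load hc N i u (ε / 4) ((1 - ε / 2) * p)) 1
  rw [one_mul] at h
  refine (measureReal_mono fun ω hω => ?_).trans (h.trans (integral_exp_load_le hc hε hε1 N i u))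
  have h1 : 0 < load N c i u (seeds i ω) - (1 - ε / 2) * p := by
    by_contra hle
    have h0 : 0 < excess N c ((1 - ε / 2) * p) i u (seeds i ω) := hω
    rw [excess, max_eq_right (not_lt.1 hle)] at h0
    exact lt_irrefl _ h0
  exact Real.one_le_exp (by positivity)

/-- The positive part of `y` is at most `4 / ε * exp (ε / 4 * y)`, so the Chernoff moment bounds the
mean too. -/
lemma integral_excess_le (hε : 0 < ε) (hε1 : ε ≤ 1) (N i u : ℕ) :
    ∫ ω, excess N c ((1 - ε / 2) * p) i u (seeds i ω) ∂seedLaw n ≤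
      4 / ε * Real.exp (-(ε ^ 2 * p / 16)) := by
  refine le_trans ?_ (mul_le_mul_of_nonneg_left (integral_exp_load_le hc hε hε1 N i u)
    (by positivity))
  rw [← integral_const_mul]
  refine integral_mono_of_nonneg (Filter.Eventually.of_forall fun ω => excess_nonneg _ _ _ _ _ _)
    ((integrable_exp_load hc N i u _ _).const_mul _) (Filter.Eventually.of_forall fun ω => ?_)
  set y := load N c i u (seeds i ω) - (1 - ε / 2) * p with hy
  have h1 : y = 4 / ε * (ε / 4 * y) := by field_simp
  refine max_le ?_ (by positivity)
  change y ≤ 4 / ε * Real.exp (ε / 4 * y)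
  calc y = 4 / ε * (ε / 4 * y) := h1
    _ ≤ _ := mul_le_mul_of_nonneg_left (by linarith [Real.add_one_le_exp (ε / 4 * y)])
      (by positivity)

omit hc in
lemma load_sub_load_update (N i u : ℕ) (x : Fin n × Fin i → ℝ) (q : Fin n × Fin i) (y : ℝ) :
    load N c i u x - load N c i u (Function.update x q y) =
      hit N c u q.1 q.2 (x q) - hit N c u q.1 q.2 y := by
  rw [load, load, ← Finset.sum_sub_distrib, Finset.sum_eq_single q]
  · simp
  · intro q' _ hne
    simp [Function.update_of_ne hne]
  · simp

/-- The positive part is 1-Lipschitz, so erasing one collection changes the sum by at most its hits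
`H` in the window. As `0 ≤ H ≤ N`, the mean of `H ^ 2` is at most `N` times that of `H`, and the
means sum to at most `U.card * p`. -/
lemma variance_sum_excess_le (hε : 0 ≤ ε) (N : ℕ) (θ : ℝ) (i : ℕ) (U : Finset ℕ) :
    Var[fun ω => ∑ u ∈ U, excess N c θ i u (seeds i ω); seedLaw n] ≤ N * (U.card * p) := by
  have hES := iIndepFun_variance_le (μ := seedLaw n) (X := fun (q : Fin n × Fin i) ω => seeds i ω q)
    (fun q => measurable_seed q.1 q.2) (iIndepFun_seeds n i)
    (f := fun x => ∑ u ∈ U, excess N c θ i u x)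
    (Finset.measurable_sum _ fun u _ => measurable_excess N c θ i u)
    (M := ∑ u ∈ U, ((Fintype.card (Fin n × Fin i) : ℝ) + |θ|))
    (fun x => (Finset.abs_sum_le_sum_abs _ _).trans
      (Finset.sum_le_sum fun u _ => abs_excess_le hc N θ i u x))
    (fun q => -(((q.2 : ℕ) : ℝ) * (N + 1) + 1 + N))
    (g := fun q x => ∑ u ∈ U, hit N c u q.1 q.2 x)
    (fun q => Finset.measurable_sum _ fun u _ => measurable_hit N c u q.1 q.2) (G := N)
    (fun q x => by
      rw [abs_of_nonneg (Finset.sum_nonneg fun u _ => hit_nonneg N c u _ _ _)]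
      exact sum_hit_le hc N U _ _ _)
    (fun x q => by
      rw [← Finset.sum_sub_distrib]
      refine (Finset.abs_sum_le_sum_abs _ _).trans (Finset.sum_le_sum fun u _ => ?_)
      refine (abs_max_sub_max_le_abs _ _ _).trans ?_
      rw [sub_sub_sub_cancel_right, load_sub_load_update, hit_eq_zero hc, sub_zero,
        abs_of_nonneg (hit_nonneg N c u _ _ _)])
  refine hES.trans ?_
  have hI : ∀ q : Fin n × Fin i, Integrable
      (fun ω => ∑ u ∈ U, hit N c u q.1 q.2 (seeds i ω q)) (seedLaw n) := fun q =>
    integrable_finsetSum _ fun u _ => integrable_hit hc N u q.1 q.2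
  calc ∑ q : Fin n × Fin i, ∫ ω, (∑ u ∈ U, hit N c u q.1 q.2 (seeds i ω q)) ^ 2 ∂seedLaw n
      ≤ ∑ q : Fin n × Fin i, N * ∑ u ∈ U,
          ∫ ω, hit N c u q.1 q.2 (seed ω q.1 q.2) ∂seedLaw n := by
        refine Finset.sum_le_sum fun q _ => ?_
        rw [← integral_finsetSum _ fun u _ => integrable_hit hc N u q.1 q.2, ← integral_const_mul]
        refine integral_mono_of_nonneg (Filter.Eventually.of_forall fun ω => sq_nonneg _)
          ((hI q).const_mul _) (Filter.Eventually.of_forall fun ω => ?_)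
        dsimp only
        rw [sq]
        exact mul_le_mul_of_nonneg_right (sum_hit_le hc N U _ _ _)
          (Finset.sum_nonneg fun u _ => hit_nonneg N c u _ _ _)
    _ = N * ∑ u ∈ U, ∑ q : Fin n × Fin i,
          ∫ ω, hit N c u q.1 q.2 (seed ω q.1 q.2) ∂seedLaw n := by
        rw [← Finset.mul_sum, Finset.sum_comm]
    _ ≤ N * ∑ u ∈ U, (p : ℝ) := by
        refine mul_le_mul_of_nonneg_left (Finset.sum_le_sum fun u _ => ?_) (Nat.cast_nonneg N)
        refine (sum_integral_hit_le_mul hc N u i).trans ?_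
        nlinarith [(Nat.cast_nonneg p : (0 : ℝ) ≤ p)]
    _ = N * (U.card * p) := by simp

/-- Chebyshev: `hmean` keeps the mean of the sum below `T * η / 2`, so the event is a deviation of
at least `T * η / 2`. -/
lemma measureReal_sum_excess_ge_le (hε : 0 < ε) (hε1 : ε ≤ 1) (N i : ℕ) {U : Finset ℕ} {T η : ℝ}
    (hT : 0 < T) (hU : U.card ≤ 2 * T) (hη : 0 < η)
    (hmean : 16 / ε * Real.exp (-(ε ^ 2 * p / 16)) ≤ η) :
    (seedLaw n).real {ω | T * η ≤ ∑ u ∈ U, excess N c ((1 - ε / 2) * p) i u (seeds i ω)} ≤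
      8 * N * p / (η ^ 2 * T) := by
  set Z : Seeds n → ℝ := fun ω => ∑ u ∈ U, excess N c ((1 - ε / 2) * p) i u (seeds i ω) with hZ
  have hL : MemLp Z 2 (seedLaw n) := memLp_sum_excess hc N _ i U
  have hEZ : ∫ ω, Z ω ∂seedLaw n ≤ T * η / 2 := by
    rw [hZ, integral_finsetSum _ fun u _ => by
      simpa using (memLp_sum_excess hc N ((1 - ε / 2) * p) i {u}).integrable one_le_two]
    refine (Finset.sum_le_sum fun u _ => integral_excess_le hc hε hε1 N i u).trans ?_
    rw [Finset.sum_const, nsmul_eq_mul]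
    have h1 : (U.card : ℝ) * (4 / ε * Real.exp (-(ε ^ 2 * p / 16))) ≤
        2 * T * (4 / ε * Real.exp (-(ε ^ 2 * p / 16))) :=
      mul_le_mul_of_nonneg_right hU (by positivity)
    have h2 := mul_le_mul_of_nonneg_left hmean hT.le
    have e : T * (16 / ε * Real.exp (-(ε ^ 2 * p / 16))) =
      2 * (2 * T * (4 / ε * Real.exp (-(ε ^ 2 * p / 16)))) := by ring
    linarith
  have hpos : 0 < T * η / 2 := by positivity
  have hcheb := meas_ge_le_variance_div_sq hL hpos
  have hreal : (seedLaw n).real {ω | T * η / 2 ≤ |Z ω - ∫ ω, Z ω ∂seedLaw n|} ≤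
      Var[Z; seedLaw n] / (T * η / 2) ^ 2 :=
    ENNReal.toReal_le_of_le_ofReal (div_nonneg (variance_nonneg _ _) (sq_nonneg _)) hcheb
  refine (measureReal_mono fun ω hω => ?_).trans (hreal.trans ?_)
  · have h : T * η ≤ Z ω := hω
    have h' : T * η / 2 ≤ Z ω - ∫ ω, Z ω ∂seedLaw n := by linarith
    exact h'.trans (le_abs_self _)
  · have hvar := variance_sum_excess_le hc hε.le N ((1 - ε / 2) * p) i U
    have h1 : Var[Z; seedLaw n] ≤ N * (2 * T * p) := hvar.trans
      (mul_le_mul_of_nonneg_left (mul_le_mul_of_nonneg_right hU (Nat.cast_nonneg p))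
        (Nat.cast_nonneg N))
    calc Var[Z; seedLaw n] / (T * η / 2) ^ 2 ≤ N * (2 * T * p) / (T * η / 2) ^ 2 := by gcongr
      _ = 8 * N * p / (η ^ 2 * T) := by field_simp; ring

/-! ### Union bound over windows -/

/-- The probability that the excess has been large on average over some time window ending at
time `i`. -/
lemma measureReal_exists_window_le (hε : 0 < ε) (hε1 : ε ≤ 1) (N i k₀ : ℕ) {η : ℝ} (hη : 0 < η)
    (hmean : 16 / ε * Real.exp (-(ε ^ 2 * p / 16)) ≤ η) :
    (seedLaw n).real {ω | ∃ t < i, ((i - t : ℕ) : ℝ) * η <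
        ∑ u ∈ Finset.Ico t i, excess N c ((1 - ε / 2) * p) i u (seeds i ω)} ≤
      2 ^ k₀ * Real.exp (-(ε ^ 2 * p / 16)) + 16 * N * p / (η ^ 2 * 2 ^ k₀) := by
  set X := fun (u : ℕ) (ω : Seeds n) => excess N c ((1 - ε / 2) * p) i u (seeds i ω) with hX
  have hX0 : ∀ u ω, 0 ≤ X u ω := fun u ω => excess_nonneg _ _ _ _ _ _
  set B₀ : ℕ → Set (Seeds n) := fun u => {ω | 0 < X u ω} with hB₀
  set B : ℕ → Set (Seeds n) := fun k =>
    {ω | 2 ^ k * η ≤ ∑ u ∈ Finset.Ico (i - 2 ^ (k + 1)) i, X u ω} with hB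
  have hsub : {ω | ∃ t < i, ((i - t : ℕ) : ℝ) * η < ∑ u ∈ Finset.Ico t i, X u ω} ⊆
      (⋃ u ∈ Finset.Ico (i - 2 ^ k₀) i, B₀ u) ∪ ⋃ k ∈ Finset.Ico k₀ i, B k := by
    rintro ω ⟨t, ht, hlt⟩
    -- A short window contains a step with positive excess. A long one, of length in `[2 ^ k, 2 ^ (k
    -- + 1))`, is enlarged to the last `2 ^ (k + 1)` steps, so one event per dyadic scale is enough.
    rcases le_or_gt (i - t) (2 ^ k₀) with hsmall | hlarge
    · left
      have hpos : 0 < ∑ u ∈ Finset.Ico t i, X u ω :=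
        lt_of_le_of_lt (by positivity) hlt
      obtain ⟨u, hu, hu0⟩ := Finset.exists_lt_of_sum_lt (f := fun _ => (0 : ℝ)) (by simpa using hpos)
      rw [Finset.mem_Ico] at hu
      exact Set.mem_biUnion (Finset.mem_coe.2 (Finset.mem_Ico.2 ⟨by omega, hu.2⟩)) hu0
    · right
      have hne : i - t ≠ 0 := by omega
      have h1 := Nat.pow_log_le_self 2 hne
      have h2 := Nat.lt_pow_succ_log_self (b := 2) (by norm_num) (i - t)
      set k := Nat.log 2 (i - t) with hk
      have hk0 : k₀ ≤ k := Nat.le_log_of_pow_le (by norm_num) hlarge.le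
      have hki : k < i := by
        have := k.lt_two_pow_self
        omega
      refine Set.mem_biUnion (Finset.mem_coe.2 (Finset.mem_Ico.2 ⟨hk0, hki⟩)) ?_
      have h3 : (2 : ℝ) ^ k ≤ ((i - t : ℕ) : ℝ) := by exact_mod_cast h1
      have h4 : ∑ u ∈ Finset.Ico t i, X u ω ≤
          ∑ u ∈ Finset.Ico (i - 2 ^ (k + 1)) i, X u ω :=
        Finset.sum_le_sum_of_subset_of_nonneg (Finset.Ico_subset_Ico_left (by
          rw [Nat.succ_eq_add_one] at h2; omega)) fun u _ _ => hX0 u ω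
      exact (mul_le_mul_of_nonneg_right h3 hη.le).trans (hlt.le.trans h4)
  refine (measureReal_mono hsub).trans ((measureReal_union_le _ _).trans (add_le_add ?_ ?_))
  · refine (measureReal_biUnion_finset_le _ _).trans ((Finset.sum_le_sum fun u _ =>
      measureReal_excess_pos_le hc hε hε1 N i u).trans ?_)
    rw [Finset.sum_const, nsmul_eq_mul, Nat.card_Ico]
    refine mul_le_mul_of_nonneg_right ?_ (Real.exp_pos _).le
    exact_mod_cast (tsub_tsub_le : i - (i - 2 ^ k₀) ≤ 2 ^ k₀)
  · refine (measureReal_biUnion_finset_le _ _).trans ((Finset.sum_le_sum fun k _ =>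
      measureReal_sum_excess_ge_le hc hε hε1 N i (T := 2 ^ k) (η := η) (by positivity) ?_ hη
        hmean).trans ?_)
    · rw [Nat.card_Ico]
      have h5 : i - (i - 2 ^ (k + 1)) ≤ 2 * 2 ^ k := by rw [pow_succ]; omega
      exact_mod_cast h5
    · have e : ∀ k : ℕ, 8 * (N : ℝ) * p / (η ^ 2 * 2 ^ k) = 8 * N * p / η ^ 2 * (1 / 2) ^ k :=
        fun k => by rw [one_div, inv_pow]; field_simp
      have hgeom : ∑ k ∈ Finset.Ico k₀ i, (1 / 2 : ℝ) ^ k ≤ 2 * (1 / 2) ^ k₀ := by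
        have := geom_sum_Ico_le_of_lt_one (x := (1 / 2 : ℝ)) (by norm_num) (by norm_num)
          (m := k₀) (n := i)
        refine this.trans_eq ?_
        norm_num
        ring
      simp only [e]
      rw [← Finset.mul_sum]
      refine (mul_le_mul_of_nonneg_left hgeom (by positivity)).trans_eq ?_
      rw [one_div, inv_pow]
      field_simp
      ring

end

/-! ### Choice of parameters and conclusion -/

/-- If some counter is non-zero after `i` steps, then the excess has been large on average over some
time window ending there. -/
lemma exists_window_excess {n p N : ℕ} {ε : ℝ} (hN : 0 < N) (hp : 0 < p) (hε : 0 < ε)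
    {c : Pouring n} (hc : IsLegalPouring n p ε c) {i : ℕ} {ω : Seeds n} {j : Fin n}
    (hj : algCounter p N (seed ω) c i j ≠ 0) :
    ∃ t < i, ((i - t : ℕ) : ℝ) * (ε * p / (2 * (N + 2))) <
      ∑ u ∈ Finset.Ico t i, excess N c ((1 - ε / 2) * p) i u (seeds i ω) := by
  have hp' : (0 : ℝ) < p := by exact_mod_cast hp
  -- Chosen so that `K * (ε / 2 * p) = N + 2`: raising the level from `(1 - ε / 2) p` to `p` pays
  -- exactly for the additive term of the queue.
  set K : ℝ := 2 * (N + 2) / (ε * p) with hK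
  have hK0 : 0 < K := by positivity
  obtain ⟨t, ht, hlt⟩ := exists_window_of_algCounter_ne_zero hN (seed ω) c hK0
    (Y := fun u => K * excess N c ((1 - ε / 2) * p) i u (seeds i ω))
    (fun u => mul_nonneg hK0.le (excess_nonneg _ _ _ _ _ _)) (i := i) (fun t ht => by
      have h1 := crossers_le hc N (seed ω) (seed_mem ω) ht
      have h2 : load N c i t (seeds i ω) - (1 - ε / 2) * p ≤
          excess N c ((1 - ε / 2) * p) i t (seeds i ω) := le_max_left _ _
      have h3 : (N : ℝ) + 2 = K * (ε / 2 * p) := by rw [hK]; field_simp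
      have h4 : (crossers N (seed ω) c t : ℝ) ≤ load N c i t (seeds i ω) := h1
      rw [h3, ← mul_add]
      exact mul_le_mul_of_nonneg_left (by linarith) hK0.le) hj
  refine ⟨t, ht, ?_⟩
  rw [← Finset.mul_sum] at hlt
  have e : ε * p / (2 * (N + 2)) = K⁻¹ := by rw [hK, inv_div]
  rw [e, ← div_eq_mul_inv, div_lt_iff₀ hK0, mul_comm]
  exact hlt

/-- The assumption on `ε` even gives `ε ^ 2 * p ≥ p ^ (1 / 3)`; the proof only needs this to be at
least 1. -/
lemma one_le_sq_mul {p : ℕ} {ε : ℝ} (hp : 1 ≤ p) (hε : (p : ℝ) ^ (-(1 / 3) : ℝ) ≤ ε) :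
    0 < ε ∧ 1 ≤ ε ^ 2 * p := by
  have hp' : (1 : ℝ) ≤ p := by exact_mod_cast hp
  have hp0 : (0 : ℝ) < p := by linarith
  have h0 : 0 < (p : ℝ) ^ (-(1 / 3) : ℝ) := Real.rpow_pos_of_pos hp0 _
  refine ⟨h0.trans_le hε, ?_⟩
  have h1 : ((p : ℝ) ^ (-(1 / 3) : ℝ)) ^ 2 * p = (p : ℝ) ^ (1 / 3 : ℝ) := by
    rw [← Real.rpow_natCast, ← Real.rpow_mul hp0.le]
    conv_lhs => rw [← Real.rpow_one (p : ℝ), ← Real.rpow_mul hp0.le, ← Real.rpow_add hp0]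
    norm_num
  calc (1 : ℝ) ≤ (p : ℝ) ^ (1 / 3 : ℝ) := Real.one_le_rpow hp' (by norm_num)
    _ = ((p : ℝ) ^ (-(1 / 3) : ℝ)) ^ 2 * p := h1.symm
    _ ≤ ε ^ 2 * p := by gcongr

/-- For `x = ε ^ 2 p`, the windows shorter than about `exp (x / 32)` contribute the first term and
the longer ones the second term. -/
lemma window_bound_le {x N : ℝ} (hx : 1 ≤ x) (hN : 0 ≤ N) (hNx : N + 2 ≤ Real.exp (x / 192)) {r : ℝ}
    (hr1 : Real.exp (x / 32) ≤ r) (hr2 : r ≤ 2 * Real.exp (x / 32)) :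
    r * Real.exp (-(x / 16)) + 64 * N * (N + 2) ^ 2 / (x * r) ≤ 66 * Real.exp (-(x / 64)) := by
  have h1 : r * Real.exp (-(x / 16)) ≤ 2 * Real.exp (-(x / 64)) := by
    calc r * Real.exp (-(x / 16)) ≤ 2 * Real.exp (x / 32) * Real.exp (-(x / 16)) := by gcongr
      _ = 2 * Real.exp (x / 32 + -(x / 16)) := by rw [Real.exp_add]; ring
      _ ≤ _ := by gcongr; linarith
  have h2 : 64 * N * (N + 2) ^ 2 / (x * r) ≤ 64 * Real.exp (-(x / 64)) := by
    have hr0 : 0 < r := (Real.exp_pos _).trans_le hr1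
    rw [div_le_iff₀ (by positivity)]
    have h3 : N * (N + 2) ^ 2 ≤ Real.exp (x / 64) := by
      calc N * (N + 2) ^ 2 ≤ (N + 2) ^ 3 := by nlinarith [sq_nonneg (N + 2)]
        _ ≤ Real.exp (x / 192) ^ 3 := by gcongr
        _ = Real.exp (x / 64) := by rw [← Real.exp_nat_mul]; congr 1; push_cast; ring
    have h4 : Real.exp (x / 64) ≤ Real.exp (-(x / 64)) * (x * r) := by
      calc Real.exp (x / 64) = Real.exp (-(x / 64)) * (1 * Real.exp (x / 32)) := by
            rw [one_mul, ← Real.exp_add]; congr 1; ring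
        _ ≤ _ := by gcongr
    nlinarith
  linarith

/-- The threshold-counter algorithm has backlog at most three with high probability. -/
lemma measureReal_backlog_thresholdEmptier {n p N : ℕ} {ε δ : ℝ} (hN : 0 < N)
    (hδ : 1 / (N : ℝ) ≤ δ) (hp : 0 < p) (hε : 0 < ε) (hε1 : ε ≤ 1) (hx : 1 ≤ ε ^ 2 * p)
    (hNx : 32 * ((N : ℝ) + 2) ≤ Real.exp (ε ^ 2 * p / 192)) {c : Pouring n}
    (hc : IsLegalPouring n p ε c) (i : ℕ) :
    1 - 66 * Real.exp (-(ε ^ 2 * p / 64)) ≤ (thresholdEmptier n p ε hN hδ).μ.real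
      {ω | (thresholdEmptier n p ε hN hδ).backlog c i ω ≤ 3} := by
  have hp' : (0 : ℝ) < p := by exact_mod_cast hp
  set x := ε ^ 2 * p with hxdef
  set η : ℝ := ε * p / (2 * (N + 2)) with hη
  have hη0 : 0 < η := by positivity
  have hmean : 16 / ε * Real.exp (-(x / 16)) ≤ η := by
    have h1 : 32 * ((N : ℝ) + 2) * Real.exp (-(x / 16)) ≤ 1 := by
      calc 32 * ((N : ℝ) + 2) * Real.exp (-(x / 16))
          ≤ Real.exp (x / 192) * Real.exp (-(x / 16)) := by gcongr
        _ = Real.exp (x / 192 + -(x / 16)) := by rw [Real.exp_add]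
        _ ≤ 1 := Real.exp_le_one_iff.2 (by linarith)
    have h2 : 16 / ε * Real.exp (-(x / 16)) =
        32 * ((N : ℝ) + 2) * Real.exp (-(x / 16)) / (ε * (2 * (N + 2))) := by
      field_simp; ring
    have h3 : η = x / (ε * (2 * (N + 2))) := by rw [hη, hxdef]; field_simp
    rw [h2, h3]
    gcongr
    linarith
  -- The cut-off is `2 ^ (k + 1)`, the power of two between `exp (x / 32)` and `2 * exp (x / 32)`.
  obtain ⟨k, hk1, hk2⟩ := exists_nat_pow_near (y := (2 : ℝ))
    (Real.one_le_exp (by linarith : 0 ≤ x / 32)) (by norm_num)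
  have hwin := measureReal_exists_window_le hc hε hε1 N i (k + 1) hη0 hmean
  have hsecond : 16 * (N : ℝ) * p / (η ^ 2 * 2 ^ (k + 1)) =
      64 * N * (N + 2) ^ 2 / (x * 2 ^ (k + 1)) := by
    rw [hη, hxdef]; field_simp; ring
  rw [hsecond] at hwin
  have hbound := hwin.trans (window_bound_le (x := x) (N := N) hx (Nat.cast_nonneg N)
    (by linarith [(Nat.cast_nonneg N : (0 : ℝ) ≤ N)]) hk2.le (by rw [pow_succ]; linarith))
  change _ ≤ (seedLaw n).real _
  set bad := {ω | ∃ t < i, ((i - t : ℕ) : ℝ) * η <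
    ∑ u ∈ Finset.Ico t i, excess N c ((1 - ε / 2) * p) i u (seeds i ω)} with hbad
  set good : Set (Seeds n) := {ω | (thresholdEmptier n p ε hN hδ).backlog c i ω ≤ 3} with hgood
  have hcover : (Set.univ : Set (Seeds n)) ⊆ good ∪ bad := fun ω _ => by
    by_cases h : ∀ j, algCounter p N (seed ω) c i j = 0
    · exact Or.inl (backlog_le_three hN hδ hc h)
    · push Not at h
      obtain ⟨j, hj⟩ := h
      exact Or.inr (exists_window_excess hN hp hε hc hj)
  have h1 := (measureReal_mono (μ := seedLaw n) hcover).trans (measureReal_union_le _ _)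
  rw [probReal_univ] at h1
  have h2 : 1 - 66 * Real.exp (-(x / 64)) ≤ (seedLaw n).real good := by linarith
  exact h2

end CupGame

theorem mainTheorem3 :
    ∃ A a C κ : ℝ, 0 < A ∧ 0 < a ∧ 0 < C ∧ 0 < κ ∧
      ∀ (n p : ℕ) (ε δ : ℝ), 1 ≤ p → (p : ℝ) ^ (-(1 / 3) : ℝ) ≤ ε → ε ≤ 1 / 2 →
        A * Real.exp (-(a * (ε ^ 2 * p))) ≤ δ → δ < 1 →
        ∃ E : CupGame.Emptier n p ε δ, E.IsThresholdCounter ⌈1 / δ⌉₊ ∧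
          ∀ c : CupGame.Pouring n, CupGame.IsLegalPouring n p ε c → ∀ i : ℕ,
            1 - C * Real.exp (-(κ * (ε ^ 2 * p))) ≤ E.μ.real {ω | E.backlog c i ω ≤ 3} := by
  -- The values 66 and 1/64 come from `window_bound_le`. The exponent 1/192 makes the cubic factor
  -- in `N` there at most `exp (ε² p / 64)`; 128 suffices since `32 (N + 2) ≤ 32 (1 / δ + 3) ≤ 128 /
  -- δ`.
  refine ⟨128, 1 / 192, 66, 1 / 64, by norm_num, by norm_num, by norm_num, by norm_num, ?_⟩
  intro n p ε δ hp hε hε2 hδA hδ1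
  obtain ⟨hε0, hx⟩ := CupGame.one_le_sq_mul hp hε
  have hexp := Real.exp_pos (-(1 / 192 * (ε ^ 2 * p)))
  have hδ0 : 0 < δ := lt_of_lt_of_le (by positivity) hδA
  have hδinv : 1 < 1 / δ := by rw [lt_div_iff₀ hδ0]; linarith
  have hN : 0 < ⌈1 / δ⌉₊ := Nat.ceil_pos.2 (by positivity)
  have hN' : (0 : ℝ) < ⌈1 / δ⌉₊ := by exact_mod_cast hN
  have hNδ : 1 / (⌈1 / δ⌉₊ : ℝ) ≤ δ := (one_div_le hN' hδ0).2 (Nat.le_ceil _)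
  have hNx : 32 * ((⌈1 / δ⌉₊ : ℝ) + 2) ≤ Real.exp (ε ^ 2 * p / 192) := by
    have h1 := Nat.ceil_lt_add_one (a := 1 / δ) (by positivity)
    have h2 : 128 * (1 / δ) ≤ Real.exp (ε ^ 2 * p / 192) := by
      rw [mul_one_div, div_le_iff₀ hδ0]
      calc (128 : ℝ) = Real.exp (ε ^ 2 * p / 192) *
            (128 * Real.exp (-(1 / 192 * (ε ^ 2 * p)))) := by
            rw [mul_left_comm, ← Real.exp_add,
              show ε ^ 2 * p / 192 + -(1 / 192 * (ε ^ 2 * p)) = 0 by ring, Real.exp_zero, mul_one]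
        _ ≤ _ := by gcongr
    linarith
  refine ⟨CupGame.thresholdEmptier n p ε hN hNδ,
    CupGame.isThresholdCounter_thresholdEmptier n p ε hN hNδ, fun c hc i => ?_⟩
  have h := CupGame.measureReal_backlog_thresholdEmptier hN hNδ hp hε0 (by linarith) hx hNx hc i
  have e : 1 / 64 * (ε ^ 2 * (p : ℝ)) = ε ^ 2 * p / 64 := by ring
  rw [e]
  exact h
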